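/- Let $m\ge 0$ be an integer. Let $J$ be multiplication by $i$ on $\mathbb R^{2m,2}=\mathbb C^{m,1}=\mathbb C^{m+1}$, with the $J$-invariant real inner product $\langle\cdot,\cdot\rangle$ satisfying $\langle z,z\rangle=\sum_{k\le m}|z_k|^2-|z_{m+1}|^2$. Let $AdS^{2m,1}=\{z:\langle z,z\rangle=-1\}$, let $\mathbb CH^m$ be the unit ball of $\mathbb C^m$ with its standard complex structure $J$ and the metric $$g_w(X,Y)=\frac{\mathrm{Re}\,\langle X,Y\rangle}{1-|w|^2}+\frac{\mathrm{Re}\,(\langle X,w\rangle\langle w,Y\rangle)}{(1-|w|^2)^2}$$ ($\langle\cdot,\cdot\rangle$ on $\mathbb C^m$ being the standard Hermitian product), and let $\pi:AdS^{2m,1}\to\mathbb CH^m$, $\pi(z)=(z_1/z_{m+1},\dots,z_m/z_{m+1})$. Let $\nu_z=z$ be the position vector; vectors are identified with covectors by the metrics, so that $J\alpha=-\alpha\circ J$ on covectors. A vector $H$ at $z\in AdS^{2m,1}$ is horizontal if it is orthogonal to $\nu_z$ and $J\nu_z$. For a $J$-invariant metric $g$ the Kähler form is $g(\cdot,J\cdot)$;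 denote by $\Omega$ the Kähler form of $\mathbb CH^m$ and by $\omega$ that of $\mathbb R^{2m,2}$. Two-forms carry the inner product in which $e\wedge f$ has norm one for orthonormal $e,f$. Let $\Lambda^2_J$ denote $J$-invariant two-forms, and $\Lambda^2_{J,0}\mathbb R^{2m,2}$ the primitive ones, i.e. those orthogonal to $\omega$. Let $\mathcal E=\Lambda^2_J\mathbb CH^m\oplus T^*\mathbb CH^m\oplus\mathbb R$ with the connection $$\nabla^{CH}_X(\xi,\alpha,u)=\Big(\nabla^g_X\xi+\tfrac12(X\wedge\alpha+JX\wedge J\alpha),\ \nabla^g_X\alpha+2\iota_X(\xi+u\Omega),\ du(X)+J\alpha(X)\Big),$$ where $\nabla^g$ is the Levi-Civita connection. Let $\mathcal N_{\mathbb CH^m}$ be the space of smooth $\nabla^{CH}$-parallel sections of $\mathcal E$, and $\mathcal N_{\mathbb CH^m,0}$ the subspace of those with $g(\xi,\Omega)=u$. For $z\in AdS^{2m,1}$ and $(\xi,\alpha,u)\in\mathcal E_{\pi(z)}$ put $$\theta_z(\xi,\alpha,u)=(d\pi_z)^*\xi+u\,J\nu\wedge\nu+\tfrac12\big(\nu\wedge(d\pi_z)^*\alpha+J\nu\wedge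 J(d\pi_z)^*\alpha\big),$$ where $d\pi_z$ is extended to $\mathbb R^{2m,2}$ by $0$ on $\nu_z$. For a section $\sigma$ of $\mathcal E$ put $(\Psi^*\sigma)_z=\theta_z(\sigma(\pi(z)))$. Let $D$ be the flat connection on $\Lambda^2_J\mathbb R^{2m,2}|_{AdS^{2m,1}}$ induced by the standard one of $\mathbb R^{2m,2}$. Then: 1. $\pi$ is surjective, its fibres are exactly the orbits of the scalar action of $\mathbb S^1$ on $AdS^{2m,1}$, and for every $z\in AdS^{2m,1}$ the differential $d\pi_z$ restricts to an isometry from the horizontal space at $z$ onto $T_{\pi(z)}\mathbb CH^m$; that is, $\mathbb CH^m=AdS^{2m,1}/\mathbb S^1$ with the induced metric. 2. Each $\theta_z:\mathcal E_{\pi(z)}\to\Lambda^2_J\mathbb R^{2m,2}$ is a linear isomorphism. The bundle map $\Psi$ given by $\Psi_z=\theta_z^{-1}$ is $\mathbb S^1$-invariant, and $\sigma\mapsto\Psi^*\sigma$ is a linear isomorphism from the smooth sections of $\mathcal E$ onto the smooth $\mathbb S^1$-invariant sections of $\Lambda^2_J\mathbb R^{2m,2}|_{AdS^{2m,1}}$.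 3. $\Psi$ identifies $D$ and $\nabla^{CH}$: for every smooth section $\sigma$ of $\mathcal E$, every $z\in AdS^{2m,1}$ and every horizontal vector $H$ at $z$, $$\nabla^{CH}_{d\pi_z(H)}\sigma=\Psi_z\big(D_H(\Psi^*\sigma)\big).$$ 4. For every $\sigma\in\mathcal N_{\mathbb CH^m}$ the form $\Psi^*\sigma$ is constant on $AdS^{2m,1}$, and $\sigma\mapsto\Psi^*\sigma$ defines linear isomorphisms $\mathcal N_{\mathbb CH^m}\cong\Lambda^2_J\mathbb R^{2m,2}$ and $\mathcal N_{\mathbb CH^m,0}\cong\Lambda^2_{J,0}\mathbb R^{2m,2}$. -/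

import Mathlib

open scoped ContDiff

noncomputable section

namespace ComplexHyperbolic

/-! ## Forms on a real normed space with an endomorphism `J`

The wedge product is normalised by `(a ∧ b)(X, Y) = a X * b Y - b X * a Y`. -/

section Linear

variable {F : Type*} [NormedAddCommGroup F] [NormedSpace ℝ F]

/-- Continuous real bilinear forms. -/
abbrev Bil (F : Type*) [NormedAddCommGroup F] [NormedSpace ℝ F] : Type _ :=
  F →L[ℝ] F →L[ℝ] ℝ

/-- Two-forms. -/
abbrev TwoForm (F : Type*) [NormedAddCommGroup F] [NormedSpace ℝ F] : Type _ :=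
  F [⋀^Fin 2]→L[ℝ] ℝ

/-- The two-form `(X, Y) ↦ B(X, Y) - B(Y, X)`. -/
def skew (B : Bil F) : TwoForm F where
  toFun v := B (v 0) (v 1) - B (v 1) (v 0)
  map_update_add' := by
    intro _ v i x y
    fin_cases i <;> simp <;> ring
  map_update_smul' := by
    intro _ v i c x
    fin_cases i <;> simp <;> ring
  map_eq_zero_of_eq' := by
    intro v i j h hij
    fin_cases i <;> fin_cases j <;> simp_all
  cont := by fun_prop

@[simp] lemma skew_apply (B : Bil F) (v : Fin 2 → F) :
    skew B v = B (v 0) (v 1) - B (v 1) (v 0) := rfl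

/-- The bilinear form `(X, Y) ↦ ξ(X, Y)` underlying a two-form `ξ`, so that `contract ξ X` is the
interior product `ι_X ξ`. -/
def contract (ξ : TwoForm F) : Bil F :=
  ((continuousMultilinearCurryFin1 ℝ F ℝ).toContinuousLinearEquiv :
    (F [×1]→L[ℝ] ℝ) →L[ℝ] F →L[ℝ] ℝ) ∘L ξ.toContinuousMultilinearMap.curryLeft

@[simp] lemma contract_apply (ξ : TwoForm F) (X Y : F) : contract ξ X Y = ξ ![X, Y] := by
  change ξ (Fin.cons X (Fin.snoc 0 Y)) = ξ ![X, Y]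
  congr 1
  ext i
  fin_cases i <;> simp

/-- The wedge product of two covectors. -/
def wedge (a b : F →L[ℝ] ℝ) : TwoForm F := skew (a.smulRight b)

/-- The action of `J` on covectors which corresponds to the action of `J` on vectors under the
identification `X ↦ g(X, ·)` given by any `J`-invariant metric: `(J α)(X) = -α (J X)`. -/
def covJ (J : F →L[ℝ] F) (α : F →L[ℝ] ℝ) : F →L[ℝ] ℝ := -(α.comp J)

/-- The space `Λ²_J` of `J`-invariant two-forms. -/
def LambdaJ (J : F →L[ℝ] F) : Submodule ℝ (TwoForm F) where
  carrier := {ξ | ∀ X Y : F, ξ ![J X, J Y] = ξ ![X, Y]}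
  zero_mem' := by simp
  add_mem' := fun ha hb X Y => by simp [ha X Y, hb X Y]
  smul_mem' := fun c a ha X Y => by simp [ha X Y]

/-- The Kähler form `g(·, J ·)`; the antisymmetrisation has no effect when `g` is symmetric and
`J`-invariant. -/
def kahlerForm (g : Bil F) (J : F →L[ℝ] F) : TwoForm F :=
  (1 / 2 : ℝ) • skew (g.bilinearComp (ContinuousLinearMap.id ℝ F) J)

/-- The endomorphism `A` with `ξ(X, Y) = g(A X, Y)`, for a nondegenerate `g`. -/
def toEnd (g : Bil F) (ξ : TwoForm F) : F →ₗ[ℝ] F where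
  toFun X := g.inverse (contract ξ X)
  map_add' X Y := by rw [map_add, map_add]
  map_smul' c X := by rw [map_smul, map_smul, RingHom.id_apply]

/-- The inner product induced on two-forms by a (pseudo-)Riemannian inner product `g`, normalised
so that `e ∧ f` has norm one for orthonormal `e, f`. If `ξ(X, Y) = g(A X, Y)` and
`η(X, Y) = g(B X, Y)`, then it is `-tr(A B) / 2`, that is
`(1/2) ∑ i j, ε i * ε j * ξ (e i) (e j) * η (e i) (e j)` in a `g`-orthonormal basis. -/
def formInner (g : Bil F) (ξ η : TwoForm F) : ℝ :=
  -(1 / 2) * LinearMap.trace ℝ F (toEnd g ξ ∘ₗ toEnd g η)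

lemma toEnd_add (g : Bil F) (ξ ξ' : TwoForm F) : toEnd g (ξ + ξ') = toEnd g ξ + toEnd g ξ' := by
  ext X
  have h : contract (ξ + ξ') X = contract ξ X + contract ξ' X := by ext Y; simp
  change g.inverse (contract (ξ + ξ') X) = g.inverse (contract ξ X) + g.inverse (contract ξ' X)
  rw [h, map_add]

lemma toEnd_smul (c : ℝ) (g : Bil F) (ξ : TwoForm F) : toEnd g (c • ξ) = c • toEnd g ξ := by
  ext X
  have h : contract (c • ξ) X = c • contract ξ X := by ext Y; simp
  change g.inverse (contract (c • ξ) X) = c • g.inverse (contract ξ X)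
  rw [h, map_smul]

lemma formInner_add (g : Bil F) (ξ ξ' η : TwoForm F) :
    formInner g (ξ + ξ') η = formInner g ξ η + formInner g ξ' η := by
  rw [formInner, toEnd_add, LinearMap.add_comp, map_add, mul_add, formInner, formInner]

lemma formInner_smul (c : ℝ) (g : Bil F) (ξ η : TwoForm F) :
    formInner g (c • ξ) η = c * formInner g ξ η := by
  rw [formInner, toEnd_smul, LinearMap.smul_comp, map_smul, formInner, smul_eq_mul]
  ring

lemma formInner_zero (g : Bil F) (η : TwoForm F) : formInner g 0 η = 0 := by
  have := formInner_smul 0 g 0 η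
  rwa [zero_smul, zero_mul] at this

/-- The space `Λ²_{J,0}` of primitive `J`-invariant two-forms: those orthogonal to the Kähler
form. -/
def LambdaJ0 (g : Bil F) (J : F →L[ℝ] F) : Submodule ℝ (TwoForm F) where
  carrier := {ξ | ξ ∈ LambdaJ J ∧ formInner g ξ (kahlerForm g J) = 0}
  zero_mem' := ⟨zero_mem _, formInner_zero _ _⟩
  add_mem' := by
    rintro a b ⟨ha, ha'⟩ ⟨hb, hb'⟩
    exact ⟨add_mem ha hb, by rw [formInner_add, ha', hb', add_zero]⟩
  smul_mem' := by
    rintro c a ⟨ha, ha'⟩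
    exact ⟨Submodule.smul_mem _ c ha, by rw [formInner_smul, ha', mul_zero]⟩

/-- The space of all triples (two-form, covector, real number). -/
abbrev Triple (F : Type*) [NormedAddCommGroup F] [NormedSpace ℝ F] : Type _ :=
  TwoForm F × (F →L[ℝ] ℝ) × ℝ

/-- The fibre `Λ²_J ⊕ T* ⊕ ℝ` of the bundle `𝓔`. -/
def FibreE (J : F →L[ℝ] F) : Submodule ℝ (Triple F) := (LambdaJ J).prod ⊤

end Linear

/-! ## Smooth maps on subsets and their derivatives -/

section Smooth

variable {F : Type*} {W : Type*} {S : Set F}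

section Extension

variable [AddCommGroup W]

/-- Extension by zero outside `S`. It only serves to apply Mathlib's notions of calculus within
`S`, which do not depend on the values outside `S`. -/
def extZero (f : S → W) : F → W := Function.extend Subtype.val f 0

lemma extZero_apply (f : S → W) (x : S) : extZero f x = f x :=
  Subtype.val_injective.extend_apply f 0 x

lemma extZero_add (f g : S → W) : extZero (f + g) = extZero f + extZero g := by
  have h := Function.extend_add (Subtype.val : S → F) f g 0 0
  rw [add_zero] at h
  exact h

lemma extZero_smul [Module ℝ W] (c : ℝ) (f : S → W) : extZero (c • f) = c • extZero f := by
  have h := Function.extend_smul c (Subtype.val : S → F) f 0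
  rw [smul_zero] at h
  exact h

end Extension

variable [NormedAddCommGroup F] [NormedSpace ℝ F] [NormedAddCommGroup W] [NormedSpace ℝ W]

/-- Smoothness of a map defined on `S` (an open set or an embedded submanifold). -/
def IsSmooth (f : S → W) : Prop := ContDiffOn ℝ ∞ (extZero f) S

/-- The derivative of a map defined on `S` at `x ∈ S`, in the direction of a vector `X` tangent
to `S` at `x`. -/
def dirDeriv (f : S → W) (x : S) (X : F) : W := fderivWithin ℝ (extZero f) S x X

lemma IsSmooth.add {f g : S → W} (hf : IsSmooth f) (hg : IsSmooth g) : IsSmooth (f + g) := by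
  unfold IsSmooth; rw [extZero_add]; exact ContDiffOn.add hf hg

lemma IsSmooth.smul {f : S → W} (c : ℝ) (hf : IsSmooth f) : IsSmooth (c • f) := by
  unfold IsSmooth; rw [extZero_smul]; exact hf.const_smul c

lemma IsSmooth.zero : IsSmooth (0 : S → W) := by
  have h : extZero (0 : S → W) = 0 := by
    have := extZero_smul (0 : ℝ) (0 : S → W)
    simpa using this
  unfold IsSmooth; rw [h]; exact contDiffOn_const

lemma IsSmooth.differentiableWithinAt {f : S → W} (hf : IsSmooth f) (x : S) :
    DifferentiableWithinAt ℝ (extZero f) S x :=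
  (ContDiffOn.differentiableOn hf (by simp)) x x.2

lemma IsSmooth.clm {W' : Type*} [NormedAddCommGroup W'] [NormedSpace ℝ W'] {f : S → W}
    (hf : IsSmooth f) (L : W →L[ℝ] W') : IsSmooth (fun x => L (f x)) := by
  have h : ContDiffOn ℝ ∞ (fun x => L (extZero f x)) S := L.contDiff.comp_contDiffOn hf
  refine h.congr fun x hx => ?_
  rw [extZero_apply (fun x : S => L (f x)) ⟨x, hx⟩, extZero_apply f ⟨x, hx⟩]

lemma dirDeriv_add (hS : IsOpen S) {f g : S → W} (hf : IsSmooth f) (hg : IsSmooth g) (x : S)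
    (X : F) : dirDeriv (f + g) x X = dirDeriv f x X + dirDeriv g x X := by
  unfold dirDeriv
  rw [extZero_add, fderivWithin_add (hS.uniqueDiffWithinAt x.2) (hf.differentiableWithinAt x)
    (hg.differentiableWithinAt x)]
  rfl

lemma dirDeriv_smul (hS : IsOpen S) {f : S → W} (c : ℝ) (hf : IsSmooth f) (x : S)
    (X : F) : dirDeriv (c • f) x X = c • dirDeriv f x X := by
  unfold dirDeriv
  rw [extZero_smul, fderivWithin_const_smul (hS.uniqueDiffWithinAt x.2)
    (hf.differentiableWithinAt x)]
  rfl

end Smooth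

/-! ## The connection `∇^{CH}` on an open set of a real vector space

The open set carries a metric `g` and a constant complex structure `J` (a complex chart). -/

section Connection

variable {F : Type*} [NormedAddCommGroup F] [NormedSpace ℝ F] {U : Set F}

/-- The Christoffel symbol `Y ↦ Γ_w(X, Y)` of the Levi-Civita connection of `g`: the endomorphism
determined by the Koszul formula for constant vector fields
`2 g(Γ(X, Y), Z) = (D_X g)(Y, Z) + (D_Y g)(X, Z) - (D_Z g)(X, Y)`. -/
def christoffel (g : F → Bil F) (w X : F) : F →L[ℝ] F :=
  Classical.epsilon fun A : F →L[ℝ] F => ∀ Y Z : F, 2 * g w (A Y) Z =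
    fderiv ℝ (fun x => g x Y Z) w X + fderiv ℝ (fun x => g x X Z) w Y
      - fderiv ℝ (fun x => g x X Y) w Z

/-- The Levi-Civita derivative `∇_X α` of a one-form. -/
def nablaCov (g : F → Bil F) (α : U → F →L[ℝ] ℝ) (w : U) (X : F) : F →L[ℝ] ℝ :=
  dirDeriv α w X - (α w).comp (christoffel g w X)

/-- The Levi-Civita derivative of a two-form,
`(∇_X ξ)(Y, Z) = (D_X ξ)(Y, Z) - ξ(Γ(X, Y), Z) - ξ(Y, Γ(X, Z))`. -/
def nablaForm (g : F → Bil F) (ξ : U → TwoForm F) (w : U) (X : F) : TwoForm F :=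
  dirDeriv ξ w X - skew ((contract (ξ w)).comp (christoffel g w X))

lemma nablaForm_apply (g : F → Bil F) (ξ : U → TwoForm F) (w : U) (X Y Z : F) :
    nablaForm g ξ w X ![Y, Z] = dirDeriv ξ w X ![Y, Z]
      - ξ w ![christoffel g w X Y, Z] - ξ w ![Y, christoffel g w X Z] := by
  have h : ξ w ![christoffel g w X Z, Y] = -ξ w ![Y, christoffel g w X Z] := by
    have := (ξ w).map_swap ![Y, christoffel g w X Z] (i := 0) (j := 1) (by decide)
    refine Eq.trans (congrArg (ξ w) ?_) this
    ext i
    fin_cases i <;> simp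
  simp [nablaForm, h]
  ring

/-- The connection `∇^{CH}_X (ξ, α, u)`; vectors are identified with covectors through `g`. -/
def nablaCH (g : F → Bil F) (J : F →L[ℝ] F) (σ : U → Triple F) (w : U) (X : F) : Triple F :=
  let ξ : U → TwoForm F := fun x => (σ x).1
  let α : U → F →L[ℝ] ℝ := fun x => (σ x).2.1
  let u : U → ℝ := fun x => (σ x).2.2
  (nablaForm g ξ w X
      + (1 / 2 : ℝ) • (wedge (g w X) (α w) + wedge (g w (J X)) (covJ J (α w))),
    nablaCov g α w X + (2 : ℝ) • contract (ξ w + u w • kahlerForm (g w) J) X,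
    dirDeriv u w X + covJ J (α w) X)

/-- The space `Γ(𝓔)` of smooth sections of `𝓔` over `U`. -/
def SectionsE (J : F →L[ℝ] F) (U : Set F) : Submodule ℝ (U → Triple F) where
  carrier := {σ | IsSmooth σ ∧ ∀ w, σ w ∈ FibreE J}
  zero_mem' := ⟨IsSmooth.zero, fun _ => zero_mem _⟩
  add_mem' := fun h h' => ⟨h.1.add h'.1, fun w => add_mem (h.2 w) (h'.2 w)⟩
  smul_mem' := fun c _ h => ⟨h.1.smul c, fun w => Submodule.smul_mem _ c (h.2 w)⟩

lemma nablaCH_add (hU : IsOpen U) (g : F → Bil F) (J : F →L[ℝ] F) {σ τ : U → Triple F}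
    (hσ : IsSmooth σ) (hτ : IsSmooth τ) (w : U) (X : F) :
    nablaCH g J (σ + τ) w X = nablaCH g J σ w X + nablaCH g J τ w X := by
  let p1 := ContinuousLinearMap.fst ℝ (TwoForm F) ((F →L[ℝ] ℝ) × ℝ)
  let p' := ContinuousLinearMap.snd ℝ (TwoForm F) ((F →L[ℝ] ℝ) × ℝ)
  let p2 := (ContinuousLinearMap.fst ℝ (F →L[ℝ] ℝ) ℝ) ∘L p'
  let p3 := (ContinuousLinearMap.snd ℝ (F →L[ℝ] ℝ) ℝ) ∘L p'
  have h1 := dirDeriv_add hU (hσ.clm p1) (hτ.clm p1) w X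
  have h2 := dirDeriv_add hU (hσ.clm p2) (hτ.clm p2) w X
  have h3 := dirDeriv_add hU (hσ.clm p3) (hτ.clm p3) w X
  refine Prod.ext ?_ (Prod.ext ?_ ?_)
  · refine Eq.trans (congrArg (fun t => t - _ + _) h1) ?_
    ext v
    simp [nablaCH, nablaForm, wedge, covJ, p1]
    ring
  · refine Eq.trans (congrArg (fun t => t - _ + _) h2) ?_
    ext Y
    simp [nablaCH, nablaCov, p2, p']
    ring
  · refine Eq.trans (congrArg (fun t => t + _) h3) ?_
    simp [nablaCH, covJ, p3, p']
    ring

lemma nablaCH_smul (hU : IsOpen U) (g : F → Bil F) (J : F →L[ℝ] F) (c : ℝ) {σ : U → Triple F}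
    (hσ : IsSmooth σ) (w : U) (X : F) :
    nablaCH g J (c • σ) w X = c • nablaCH g J σ w X := by
  let p1 := ContinuousLinearMap.fst ℝ (TwoForm F) ((F →L[ℝ] ℝ) × ℝ)
  let p' := ContinuousLinearMap.snd ℝ (TwoForm F) ((F →L[ℝ] ℝ) × ℝ)
  let p2 := (ContinuousLinearMap.fst ℝ (F →L[ℝ] ℝ) ℝ) ∘L p'
  let p3 := (ContinuousLinearMap.snd ℝ (F →L[ℝ] ℝ) ℝ) ∘L p'
  have h1 := dirDeriv_smul hU c (hσ.clm p1) w X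
  have h2 := dirDeriv_smul hU c (hσ.clm p2) w X
  have h3 := dirDeriv_smul hU c (hσ.clm p3) w X
  refine Prod.ext ?_ (Prod.ext ?_ ?_)
  · refine Eq.trans (congrArg (fun t => t - _ + _) h1) ?_
    ext v
    simp [nablaCH, nablaForm, wedge, covJ, p1]
    ring
  · refine Eq.trans (congrArg (fun t => t - _ + _) h2) ?_
    ext Y
    simp [nablaCH, nablaCov, p2, p']
    ring
  · refine Eq.trans (congrArg (fun t => t + _) h3) ?_
    simp [nablaCH, covJ, p3, p']
    ring

/-- The space `𝓝` of `∇^{CH}`-parallel sections of `𝓔` over the open set `U`. -/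
def ParallelE (g : F → Bil F) (J : F →L[ℝ] F) (U : Set F) (hU : IsOpen U) :
    Submodule ℝ (U → Triple F) where
  carrier := {σ | σ ∈ SectionsE J U ∧ ∀ w X, nablaCH g J σ w X = 0}
  zero_mem' := by
    refine ⟨zero_mem _, fun w X => ?_⟩
    have := nablaCH_smul hU g J 0 (IsSmooth.zero (W := Triple F) (S := U)) w X
    simpa using this
  add_mem' := by
    rintro σ τ ⟨hσ, hσ'⟩ ⟨hτ, hτ'⟩
    exact ⟨add_mem hσ hτ, fun w X => by rw [nablaCH_add hU g J hσ.1 hτ.1, hσ', hτ', add_zero]⟩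
  smul_mem' := by
    rintro c σ ⟨hσ, hσ'⟩
    exact ⟨Submodule.smul_mem _ c hσ,
      fun w X => by rw [nablaCH_smul hU g J c hσ.1, hσ', smul_zero]⟩

/-- The space `𝓝₀` of the parallel sections `(ξ, α, u)` with `g(ξ, Ω) = u`. -/
def ParallelE0 (g : F → Bil F) (J : F →L[ℝ] F) (U : Set F) (hU : IsOpen U) :
    Submodule ℝ (U → Triple F) where
  carrier := {σ | σ ∈ ParallelE g J U hU ∧
    ∀ w : U, formInner (g w) (σ w).1 (kahlerForm (g w) J) = (σ w).2.2}
  zero_mem' := ⟨zero_mem _, fun w => formInner_zero _ _⟩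
  add_mem' := by
    rintro σ τ ⟨hσ, hσ'⟩ ⟨hτ, hτ'⟩
    refine ⟨add_mem hσ hτ, fun w => ?_⟩
    have := formInner_add (g w) (σ w).1 (τ w).1 (kahlerForm (g w) J)
    rw [hσ', hτ'] at this
    exact this
  smul_mem' := by
    rintro c σ ⟨hσ, hσ'⟩
    refine ⟨Submodule.smul_mem _ c hσ, fun w => ?_⟩
    have := formInner_smul c (g w) (σ w).1 (kahlerForm (g w) J)
    rw [hσ'] at this
    exact this

end Connection

/-! ## Anti-de Sitter space and the complex hyperbolic space -/

/-- Multiplication by `i`, as a real linear map. -/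
def mulI (F : Type*) [NormedAddCommGroup F] [NormedSpace ℝ F] [NormedSpace ℂ F]
    [IsScalarTower ℝ ℂ F] : F →L[ℝ] F :=
  (Complex.I • ContinuousLinearMap.id ℂ F).restrictScalars ℝ

/-- The vector space `ℂ^m`. -/
abbrev Cm (m : ℕ) : Type := EuclideanSpace ℂ (Fin m)

/-- The vector space `ℂ^{m+1} = ℂ^m × ℂ` underlying `ℂ^{m,1} = ℝ^{2m,2}`. -/
abbrev Vm (m : ℕ) : Type := Cm m × ℂ

/-- The real inner product of `ℝ^{2m,2}`, with
`⟨z, z⟩ = |z_1|² + ... + |z_m|² - |z_{m+1}|²`. -/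
def mink (m : ℕ) : Bil (Vm m) :=
  (innerSL ℝ : Bil (Cm m)).bilinearComp (ContinuousLinearMap.fst ℝ (Cm m) ℂ)
      (ContinuousLinearMap.fst ℝ (Cm m) ℂ)
    - (innerSL ℝ : Bil ℂ).bilinearComp (ContinuousLinearMap.snd ℝ (Cm m) ℂ)
      (ContinuousLinearMap.snd ℝ (Cm m) ℂ)

lemma mink_self (m : ℕ) (z : Vm m) : mink m z z = ‖z.1‖ ^ 2 - ‖z.2‖ ^ 2 := by
  simp only [mink, sub_apply, ContinuousLinearMap.bilinearComp_apply,
    ContinuousLinearMap.coe_fst', ContinuousLinearMap.coe_snd', innerSL_apply_apply,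
    real_inner_self_eq_norm_sq]

/-- Anti-de Sitter space `AdS^{2m,1}`. -/
def AdS (m : ℕ) : Set (Vm m) := {z | mink m z z = -1}

/-- The complex hyperbolic space `ℂH^m`, in its ball model. -/
def CH (m : ℕ) : Set (Cm m) := Metric.ball 0 1

lemma isOpen_CH (m : ℕ) : IsOpen (CH m) := Metric.isOpen_ball

/-- The metric of `ℂH^m` (of holomorphic sectional curvature `-4`):
`g_w(X, Y) = Re⟨X, Y⟩ / (1 - |w|²) + Re(⟨X, w⟩⟨w, Y⟩) / (1 - |w|²)²`, with the standard Hermitian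
product of `ℂ^m`. -/
def metricCH (m : ℕ) (w : Cm m) : Bil (Cm m) :=
  (1 - ‖w‖ ^ 2)⁻¹ • (innerSL ℝ : Bil (Cm m))
    + ((1 - ‖w‖ ^ 2) ^ 2)⁻¹ • (innerSL ℝ : Bil ℂ).bilinearComp
      ((innerSL ℂ w).restrictScalars ℝ) ((innerSL ℂ w).restrictScalars ℝ)

/-- The map `z ↦ (z_1 / z_{m+1}, ..., z_m / z_{m+1})`. -/
def projMap (m : ℕ) (z : Vm m) : Cm m := z.2⁻¹ • z.1

lemma projMap_mem {m : ℕ} {z : Vm m} (hz : z ∈ AdS m) : projMap m z ∈ CH m := by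
  have h : ‖z.1‖ ^ 2 - ‖z.2‖ ^ 2 = -1 := by rw [← mink_self]; exact hz
  have hlt : ‖z.1‖ < ‖z.2‖ := lt_of_pow_lt_pow_left₀ 2 (norm_nonneg _) (by linarith)
  have hpos : 0 < ‖z.2‖ := (norm_nonneg _).trans_lt hlt
  simp only [CH, projMap, Metric.mem_ball, dist_zero_right, norm_smul, norm_inv]
  rwa [inv_mul_lt_iff₀ hpos, mul_one]

/-- The projection `π : AdS^{2m,1} → ℂH^m`. -/
def proj (m : ℕ) (z : AdS m) : CH m := ⟨projMap m z, projMap_mem z.2⟩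

/-- The differential of `π` at `z`, extended to the whole of `ℝ^{2m,2}` by `0` on the line
spanned by `z` (along which `projMap` is constant). -/
def dproj (m : ℕ) (z : AdS m) : Vm m →L[ℝ] Cm m := fderiv ℝ (projMap m) z

/-- The horizontal space at `z`: the orthogonal of `ν = z` and `J ν`. -/
def horizontal (m : ℕ) (z : AdS m) : Set (Vm m) :=
  {H | mink m z H = 0 ∧ mink m (mulI (Vm m) z) H = 0}

/-- The map `θ_z(ξ, α, u) = π^*ξ + u Jν ∧ ν + (ν ∧ π^*α + Jν ∧ J π^*α) / 2`, where `ν = z` and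
vectors are identified with covectors through the inner product of `ℝ^{2m,2}`. -/
def theta (m : ℕ) (z : AdS m) (e : Triple (Cm m)) : TwoForm (Vm m) :=
  let J := mulI (Vm m)
  let ν : Vm m →L[ℝ] ℝ := mink m z
  let Jν : Vm m →L[ℝ] ℝ := mink m (J z)
  let α : Vm m →L[ℝ] ℝ := e.2.1.comp (dproj m z)
  e.1.compContinuousLinearMap (dproj m z) + e.2.2 • wedge Jν ν
    + (1 / 2 : ℝ) • (wedge ν α + wedge Jν (covJ J α))

/-- The form `Ψ^*σ` on `AdS` which corresponds to the section `σ`. -/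
def pullSection (m : ℕ) (σ : CH m → Triple (Cm m)) (z : AdS m) : TwoForm (Vm m) :=
  theta m z (σ (proj m z))

/-- The space `Γ(Λ²_J ℝ^{2m,2}|_{AdS})^{𝕊¹}` of smooth `𝕊¹`-invariant sections. -/
def InvariantSections (m : ℕ) : Submodule ℝ (AdS m → TwoForm (Vm m)) where
  carrier := {Φ | IsSmooth Φ ∧ (∀ z, Φ z ∈ LambdaJ (mulI (Vm m))) ∧
    ∀ (c : Circle) (z z' : AdS m), (z' : Vm m) = (c : ℂ) • (z : Vm m) →
      ∀ X Y : Vm m, Φ z' ![(c : ℂ) • X, (c : ℂ) • Y] = Φ z ![X, Y]}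
  zero_mem' := ⟨IsSmooth.zero, fun _ => zero_mem _, by simp⟩
  add_mem' := by
    rintro Φ Φ' ⟨h0, h1, h2⟩ ⟨h0', h1', h2'⟩
    refine ⟨h0.add h0', fun z => add_mem (h1 z) (h1' z), fun c z z' h X Y => ?_⟩
    simp [h2 c z z' h X Y, h2' c z z' h X Y]
  smul_mem' := by
    rintro r Φ ⟨h0, h1, h2⟩
    refine ⟨h0.smul r, fun z => Submodule.smul_mem _ r (h1 z), fun c z z' h X Y => ?_⟩
    simp [h2 c z z' h X Y]

end ComplexHyperbolic

end

open ComplexHyperbolic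

/-!
The proof rests on an explicit formula for `θ_z`. Let `h(z, Z) = ⟨z₁, Z₁⟩ - conj(z₂) Z₂` be the
Hermitian form of signature `(m, 1)` whose real part is the given inner product. For `z ∈ AdS` every
vector is `P = L_z(dπ_z P) - h(z, P) z`, where the horizontal lift `L_z` is adjoint to `dπ_z`
(`hlift_dprojV`, `mink_hlift`). In terms of the projections of `P` and `Q` and of the complex
numbers `h(z, P)`, `h(z, Q)`, the value `θ_z(ξ, α, u)(P, Q)` is a polynomial expression
(`theta_apply`), and the inverse of `θ_z` is read off by evaluating on lifts, on `ν` and on `Jν`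
(`psi`, `psi_theta`, `theta_psi`). Since a `J`-invariant form is preserved by unit complex scalars,
an `𝕊¹`-invariant section is constant on the fibres of `π`, so it is recovered from its restriction
to the image of the global smooth section `sec` of `π`; this gives the isomorphism of spaces of
sections.

For the connections, the Koszul formula gives the Christoffel symbols
`Γ_w(X, Y) = (⟨w, X⟩ Y + ⟨w, Y⟩ X) / (1 - |w|²)` of `ℂH^m` (`christoffel_metricCH`). The second
derivative of the projection in a horizontal direction `H` is
`P ↦ -Γ(dπ H, dπ P) + h(z, P) dπ H` (`hasDerivAt_dprojV_comp`). Differentiating `theta_apply` along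
a curve in `AdS` with velocity `H`, the terms in `Γ` turn derivatives into covariant derivatives,
and the remaining terms are exactly the algebraic terms of `∇^{CH}` (`dirDeriv_pullSection`).

For a parallel section `σ` the form `Ψ^*σ` descends to a map on the ball with vanishing derivative,
so it is constant; conversely a constant `J`-invariant form is an invariant section with vanishing
flat derivative (`pullSection_eq_of_parallel`, `descend_const_mem`). Finally the inner product of
`θ_z(ξ, α, u)` with the Kähler form of `ℝ^{2m,2}` is `g(ξ, Ω) - u` (`formInner_theta`): the Kähler
form corresponds to the endomorphism `-J`, so that the inner product is a trace, which is compared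
with the one on `ℂH^m` by cyclicity. Hence `𝓝₀` corresponds to the primitive forms.
-/

noncomputable section

namespace ComplexHyperbolic

/-! ### Two-forms and bilinear forms -/

section Forms

variable {F : Type*} [NormedAddCommGroup F] [NormedSpace ℝ F]

lemma twoForm_ext {ξ η : TwoForm F} (h : ∀ X Y, ξ ![X, Y] = η ![X, Y]) : ξ = η := by
  ext v
  have hv : v = ![v 0, v 1] := by ext i; fin_cases i <;> rfl
  rw [hv]
  exact h _ _

lemma wedge_apply (a b : F →L[ℝ] ℝ) (X Y : F) : wedge a b ![X, Y] = a X * b Y - a Y * b X := by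
  simp [wedge]

@[simp] lemma covJ_apply (J : F →L[ℝ] F) (α : F →L[ℝ] ℝ) (X : F) : covJ J α X = -α (J X) := rfl

lemma form_swap (ξ : TwoForm F) (X Y : F) : ξ ![Y, X] = -ξ ![X, Y] := by
  have := ξ.map_swap ![X, Y] (i := 0) (j := 1) (by decide)
  refine Eq.trans (congrArg ξ ?_) this
  ext i
  fin_cases i <;> simp

lemma form_self (ξ : TwoForm F) (X : F) : ξ ![X, X] = 0 := by
  have := form_swap ξ X X
  linarith

/-- The map `contract`, sending a two-form to the underlying bilinear form, as a continuous linear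
map. -/
def contractL (F : Type*) [NormedAddCommGroup F] [NormedSpace ℝ F] : TwoForm F →L[ℝ] Bil F :=
  LinearMap.mkContinuous
    { toFun := contract
      map_add' := fun ξ η => by ext X Y; simp
      map_smul' := fun c ξ => by ext X Y; simp } 1 fun ξ => by
    rw [one_mul]
    refine ContinuousLinearMap.opNorm_le_bound _ (norm_nonneg _) fun X => ?_
    refine ContinuousLinearMap.opNorm_le_bound _ (by positivity) fun Y => ?_
    have := ξ.le_opNorm ![X, Y]
    simpa [Fin.prod_univ_two, mul_assoc] using this

@[simp] lemma contractL_apply (ξ : TwoForm F) (X Y : F) : contractL F ξ X Y = ξ ![X, Y] :=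
  contract_apply ξ X Y

lemma contDiff_contractL : ContDiff ℝ ∞ (contractL F) := ContinuousLinearMap.contDiff _

lemma form_add_left (ξ : TwoForm F) (X X' Y : F) :
    ξ ![X + X', Y] = ξ ![X, Y] + ξ ![X', Y] := by
  simp only [← contract_apply, map_add, add_apply]

lemma form_add_right (ξ : TwoForm F) (X Y Y' : F) :
    ξ ![X, Y + Y'] = ξ ![X, Y] + ξ ![X, Y'] := by
  simp only [← contract_apply, map_add]

lemma form_sub_left (ξ : TwoForm F) (X X' Y : F) :
    ξ ![X - X', Y] = ξ ![X, Y] - ξ ![X', Y] := by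
  simp only [← contract_apply, map_sub, sub_apply]

lemma form_sub_right (ξ : TwoForm F) (X Y Y' : F) :
    ξ ![X, Y - Y'] = ξ ![X, Y] - ξ ![X, Y'] := by
  simp only [← contract_apply, map_sub]

lemma form_smul_left (ξ : TwoForm F) (c : ℝ) (X Y : F) : ξ ![c • X, Y] = c * ξ ![X, Y] := by
  simp only [← contract_apply, map_smul, smul_apply, smul_eq_mul]

lemma form_smul_right (ξ : TwoForm F) (c : ℝ) (X Y : F) : ξ ![X, c • Y] = c * ξ ![X, Y] := by
  simp only [← contract_apply, map_smul, smul_eq_mul]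

/-- The antisymmetrisation of bilinear forms as a continuous linear map. -/
def skewL (F : Type*) [NormedAddCommGroup F] [NormedSpace ℝ F] [FiniteDimensional ℝ F] :
    Bil F →L[ℝ] TwoForm F :=
  LinearMap.toContinuousLinearMap
    { toFun := skew
      map_add' := fun B C => by ext v; simp; ring
      map_smul' := fun c B => by ext v; simp; ring }

lemma skewL_apply [FiniteDimensional ℝ F] (B : Bil F) : skewL F B = skew B := rfl

/-- The map `skew / 2` is a left inverse of `contract`. -/
lemma half_skew_contractL [FiniteDimensional ℝ F] (ξ : TwoForm F) :
    (1 / 2 : ℝ) • skewL F (contractL F ξ) = ξ := by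
  refine twoForm_ext fun X Y => ?_
  have := form_swap ξ X Y
  simp only [skewL_apply, ContinuousAlternatingMap.smul_apply, skew_apply, contractL_apply,
    smul_eq_mul]
  simp only [Matrix.cons_val_zero, Matrix.cons_val_one, this]
  ring

/-- Smoothness of a map into two-forms may be checked on the values at pairs of vectors. -/
lemma contDiffOn_twoForm {E : Type*} [NormedAddCommGroup E] [NormedSpace ℝ E]
    [FiniteDimensional ℝ F] {f : E → TwoForm F} {s : Set E}
    (h : ∀ X Y, ContDiffOn ℝ ∞ (fun x => f x ![X, Y]) s) : ContDiffOn ℝ ∞ f s := by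
  have h1 : ContDiffOn ℝ ∞ (fun x => contractL F (f x)) s := by
    rw [contDiffOn_clm_apply]
    intro X
    rw [contDiffOn_clm_apply]
    intro Y
    simpa using h X Y
  have h2 := ((skewL F).contDiff.comp_contDiffOn h1).const_smul (1 / 2 : ℝ)
  exact h2.congr fun x _ => (half_skew_contractL (f x)).symm

end Forms

/-! ### Complex scalars -/

section Scalars

variable {F : Type*} [NormedAddCommGroup F] [NormedSpace ℝ F] [NormedSpace ℂ F]
  [IsScalarTower ℝ ℂ F]

lemma mulI_apply (X : F) : mulI F X = Complex.I • X := rfl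

lemma complex_smul_eq (c : ℂ) (X : F) : c • X = c.re • X + c.im • (Complex.I • X) := by
  rw [← smul_assoc, ← algebraMap_smul ℂ c.re X, ← add_smul]
  congr 1
  apply Complex.ext <;> simp

lemma covector_smul (α : F →L[ℝ] ℝ) (c : ℂ) (X : F) :
    α (c • X) = c.re * α X + c.im * α (Complex.I • X) := by
  conv_lhs => rw [complex_smul_eq c X]
  simp only [map_add, map_smul, smul_eq_mul]

lemma form_csmul_left (ξ : TwoForm F) (c : ℂ) (X Y : F) :
    ξ ![c • X, Y] = c.re * ξ ![X, Y] + c.im * ξ ![Complex.I • X, Y] := by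
  conv_lhs => rw [complex_smul_eq c X]
  rw [form_add_left, form_smul_left, form_smul_left]

lemma form_csmul_right (ξ : TwoForm F) (c : ℂ) (X Y : F) :
    ξ ![X, c • Y] = c.re * ξ ![X, Y] + c.im * ξ ![X, Complex.I • Y] := by
  conv_lhs => rw [complex_smul_eq c Y]
  rw [form_add_right, form_smul_right, form_smul_right]

lemma mem_LambdaJ {ξ : TwoForm F} :
    ξ ∈ LambdaJ (mulI F) ↔ ∀ X Y, ξ ![Complex.I • X, Complex.I • Y] = ξ ![X, Y] := Iff.rfl

lemma LambdaJ_I_left {ξ : TwoForm F} (h : ξ ∈ LambdaJ (mulI F)) (X Y : F) :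
    ξ ![Complex.I • X, Y] = -ξ ![X, Complex.I • Y] := by
  rw [← mem_LambdaJ.1 h X (Complex.I • Y), smul_smul, Complex.I_mul_I, neg_one_smul,
    ← neg_one_smul ℝ Y, form_smul_right]
  ring

/-- A `J`-invariant form scales by `|c|²` under multiplication by the complex number `c`. -/
lemma LambdaJ_csmul {ξ : TwoForm F} (h : ξ ∈ LambdaJ (mulI F)) (c : ℂ) (X Y : F) :
    ξ ![c • X, c • Y] = (c.re ^ 2 + c.im ^ 2) * ξ ![X, Y] := by
  rw [form_csmul_left, form_csmul_right ξ c X, form_csmul_right ξ c (Complex.I • X),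
    mem_LambdaJ.1 h, LambdaJ_I_left h]
  ring

lemma FibreE_iff {e : Triple F} : e ∈ FibreE (mulI F) ↔ e.1 ∈ LambdaJ (mulI F) := by
  simp [FibreE, Submodule.mem_prod]

end Scalars

/-! ### The inner product of a two-form with the Kähler form -/

section Trace

variable {F : Type*} [NormedAddCommGroup F] [NormedSpace ℝ F]

lemma toEnd_spec {g : Bil F} (hg : g.IsInvertible) (ξ : TwoForm F) (X Y : F) :
    g (toEnd g ξ X) Y = ξ ![X, Y] := by
  change g (g.inverse (contract ξ X)) Y = _
  rw [← contract_apply]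
  have := hg.self_comp_inverse
  exact congrArg (fun L : (F →L[ℝ] ℝ) →L[ℝ] (F →L[ℝ] ℝ) => L (contract ξ X) Y) this

lemma toEnd_unique {g : Bil F} (hg : g.IsInvertible) {ξ : TwoForm F} {A : F →ₗ[ℝ] F}
    (h : ∀ X Y, g (A X) Y = ξ ![X, Y]) : toEnd g ξ = A := by
  refine LinearMap.ext fun X => hg.injective ?_
  ext Y
  rw [toEnd_spec hg, h]

lemma kahlerForm_apply {g : Bil F} {J : F →L[ℝ] F} (hs : ∀ X Y, g X Y = g Y X)
    (hJ : ∀ X Y, g (J X) Y = -g X (J Y)) (X Y : F) : kahlerForm g J ![X, Y] = g X (J Y) := by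
  simp [kahlerForm, hs Y (J X), hJ]
  ring

lemma isInvertible_of_nondegenerate [FiniteDimensional ℝ F] {g : Bil F}
    (h : ∀ X, (∀ Y, g X Y = 0) → X = 0) :
    g.IsInvertible := by
  have hinj : Function.Injective (g : F →ₗ[ℝ] F →L[ℝ] ℝ) := by
    rw [← LinearMap.ker_eq_bot, LinearMap.ker_eq_bot']
    exact fun X hX => h X fun Y => by
      have : g X = 0 := hX
      rw [this]; rfl
  have hdim : Module.finrank ℝ F = Module.finrank ℝ (F →L[ℝ] ℝ) := by
    rw [← (LinearMap.toContinuousLinearMap (𝕜 := ℝ) (E := F) (F' := ℝ)).finrank_eq]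
    exact (Subspace.dual_finrank_eq (K := ℝ) (V := F)).symm
  exact ⟨(LinearEquiv.ofInjectiveOfFinrankEq _ hinj hdim).toContinuousLinearEquiv, by ext; rfl⟩

/-- Since the Kähler form corresponds to the endomorphism `-J`, its inner product with a form
corresponding to `A` is `tr(A J) / 2`. -/
lemma formInner_kahler {g : Bil F} {J : F →L[ℝ] F} (hg : g.IsInvertible)
    (hs : ∀ X Y, g X Y = g Y X) (hJ : ∀ X Y, g (J X) Y = -g X (J Y)) (ξ : TwoForm F) :
    formInner g ξ (kahlerForm g J) =
      1 / 2 * LinearMap.trace ℝ F (toEnd g ξ ∘ₗ (J : F →ₗ[ℝ] F)) := by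
  have h : toEnd g (kahlerForm g J) = -(J : F →ₗ[ℝ] F) := by
    refine toEnd_unique hg fun X Y => ?_
    rw [kahlerForm_apply hs hJ]
    simp [hJ]
  rw [formInner, h, LinearMap.comp_neg, map_neg]
  ring

/-- The form `g(p, ·) ∧ b` corresponds to an endomorphism of rank at most two, whose composition
with `J` has trace `-2 b(J p)`. -/
lemma formInner_wedge_kahler [FiniteDimensional ℝ F] {g : Bil F} {J : F →L[ℝ] F}
    (hg : g.IsInvertible) (hs : ∀ X Y, g X Y = g Y X)
    (hJ : ∀ X Y, g (J X) Y = -g X (J Y)) (p : F) (b : F →L[ℝ] ℝ) :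
    formInner g (wedge (g p) b) (kahlerForm g J) = -b (J p) := by
  set q := g.inverse b
  have hq : ∀ Y, g q Y = b Y := fun Y =>
    congrArg (fun L : (F →L[ℝ] ℝ) →L[ℝ] (F →L[ℝ] ℝ) => L b Y) hg.self_comp_inverse
  have h : toEnd g (wedge (g p) b) =
      ((g p : F →ₗ[ℝ] ℝ).smulRight q) - ((b : F →ₗ[ℝ] ℝ).smulRight p) := by
    refine toEnd_unique hg fun X Y => ?_
    simp [wedge_apply, hq, mul_comm]
  have h1 : ∀ (a : F →L[ℝ] ℝ) (v : F), ((a : F →ₗ[ℝ] ℝ).smulRight v) ∘ₗ (J : F →ₗ[ℝ] F) =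
      ((a.comp J : F →L[ℝ] ℝ) : F →ₗ[ℝ] ℝ).smulRight v := fun a v => rfl
  rw [formInner_kahler hg hs hJ, h, LinearMap.sub_comp, map_sub, h1, h1, LinearMap.trace_smulRight,
    LinearMap.trace_smulRight]
  have : g p (J q) = -b (J p) := by rw [← neg_eq_iff_eq_neg, ← hJ, hs, hq]
  simp [this]
  ring

end Trace

/-! ### The Hermitian form of `ℂ^{m,1}` and the projection -/

section Geometry

open scoped ComplexConjugate

variable {m : ℕ}

/-- The Hermitian form of signature `(m, 1)` on `ℂ^{m+1}`, conjugate-linear in the first argument;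
its real part is `mink`. -/
def herm (z Z : Vm m) : ℂ := inner ℂ z.1 Z.1 - conj z.2 * Z.2

lemma real_inner_eq (x y : Cm m) : inner ℝ x y = (inner ℂ x y).re := by
  simp [PiLp.inner_apply]

lemma mink_eq (z Z : Vm m) : mink m z Z = (herm z Z).re := by
  simp [mink, herm, real_inner_eq]
  ring

lemma herm_add_right (z P Q : Vm m) : herm z (P + Q) = herm z P + herm z Q := by
  simp [herm]; ring

lemma herm_csmul_right (c : ℂ) (z P : Vm m) : herm z (c • P) = c * herm z P := by
  simp [herm]; ring

lemma herm_csmul_left (c : ℂ) (z P : Vm m) : herm (c • z) P = conj c * herm z P := by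
  simp [herm]; ring

lemma herm_conj (z P : Vm m) : conj (herm z P) = herm P z := by
  simp [herm, mul_comm]

lemma mink_I_left (z Z : Vm m) : mink m (Complex.I • z) Z = (herm z Z).im := by
  rw [mink_eq, herm_csmul_left]
  simp

lemma mink_symm (P Q : Vm m) : mink m P Q = mink m Q P := by
  rw [mink_eq, mink_eq, ← herm_conj]
  simp

lemma mink_J (P Q : Vm m) : mink m (mulI (Vm m) P) Q = -mink m P (mulI (Vm m) Q) := by
  rw [mulI_apply, mulI_apply, mink_I_left, mink_eq, herm_csmul_right]
  simp

lemma mink_nondegenerate (P : Vm m) (h : ∀ Q, mink m P Q = 0) : P = 0 := by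
  -- Pairing `(x, t)` with `(x, -t)` gives `|x|² + |t|²`.
  have h1 := h (P.1, -P.2)
  have h2 : mink m P (P.1, -P.2) = ‖P.1‖ ^ 2 + ‖P.2‖ ^ 2 := by
    simp [mink]
  rw [h2] at h1
  have h3 : ‖P.1‖ = 0 := by nlinarith [sq_nonneg ‖P.1‖, sq_nonneg ‖P.2‖]
  have h4 : ‖P.2‖ = 0 := by nlinarith [sq_nonneg ‖P.1‖, sq_nonneg ‖P.2‖]
  exact Prod.ext (norm_eq_zero.1 h3) (norm_eq_zero.1 h4)

lemma herm_self {z : Vm m} (hz : z ∈ AdS m) : herm z z = -1 := by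
  apply Complex.ext
  · rw [← mink_eq]; simpa [AdS] using hz
  · have := congrArg Complex.im (herm_conj z z)
    simp only [Complex.conj_im] at this
    simp only [Complex.neg_im, Complex.one_im, neg_zero]
    linarith

lemma AdS_norm {z : Vm m} (hz : z ∈ AdS m) : ‖z.1‖ ^ 2 - ‖z.2‖ ^ 2 = -1 := by
  rw [← mink_self]; exact hz

lemma AdS_snd_ne_zero {z : Vm m} (hz : z ∈ AdS m) : z.2 ≠ 0 := by
  intro h
  have := AdS_norm hz
  rw [h, norm_zero] at this
  nlinarith [sq_nonneg ‖z.1‖]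

lemma fst_eq_smul_projMap {z : Vm m} (hz : z.2 ≠ 0) : z.1 = z.2 • projMap m z := by
  rw [projMap, smul_inv_smul₀ hz]

lemma CH_pos {w : Cm m} (hw : w ∈ CH m) : 0 < 1 - ‖w‖ ^ 2 := by
  have h : ‖w‖ < 1 := by simpa [CH] using hw
  nlinarith [norm_nonneg w]

lemma AdS_norm_snd {z : Vm m} (hz : z ∈ AdS m) :
    ‖z.2‖ ^ 2 = (1 - ‖projMap m z‖ ^ 2)⁻¹ := by
  have h := AdS_norm hz
  have h0 := CH_pos (projMap_mem hz)
  rw [fst_eq_smul_projMap (AdS_snd_ne_zero hz), norm_smul, mul_pow] at h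
  rw [← one_div, eq_div_iff h0.ne']
  linarith

lemma conj_mul_snd {z : Vm m} (hz : z ∈ AdS m) :
    conj z.2 * z.2 = (((1 - ‖projMap m z‖ ^ 2)⁻¹ : ℝ) : ℂ) := by
  rw [← AdS_norm_snd hz, mul_comm, Complex.mul_conj, Complex.normSq_eq_norm_sq]

/-- The differential of `projMap` at `z` with `z_{m+1} ≠ 0`, given by an explicit formula; it is
complex linear, but only its underlying real linear map is recorded. -/
def dprojV (z : Vm m) : Vm m →L[ℝ] Cm m :=
  (z.2⁻¹ • (ContinuousLinearMap.fst ℂ (Cm m) ℂ -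
    (ContinuousLinearMap.snd ℂ (Cm m) ℂ).smulRight (projMap m z))).restrictScalars ℝ

lemma dprojV_apply (z P : Vm m) : dprojV z P = z.2⁻¹ • (P.1 - P.2 • projMap m z) := rfl

lemma dprojV_csmul (z : Vm m) (c : ℂ) (P : Vm m) : dprojV z (c • P) = c • dprojV z P := by
  simp only [dprojV_apply, Prod.smul_fst, Prod.smul_snd, smul_eq_mul, mul_smul, ← smul_sub]
  exact smul_comm _ _ _

lemma hasFDerivAt_projMap {z : Vm m} (hz : z.2 ≠ 0) : HasFDerivAt (projMap m) (dprojV z) z := by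
  have h1 : HasFDerivAt (fun z : Vm m => z.2⁻¹)
      ((-ContinuousLinearMap.toSpanSingleton ℂ (z.2 ^ 2)⁻¹).comp
        (ContinuousLinearMap.snd ℂ (Cm m) ℂ)) z := by
    have := (hasFDerivAt_inv hz).comp z
      (ContinuousLinearMap.snd ℂ (Cm m) ℂ).hasFDerivAt
    refine this.congr_fderiv ?_
    ext <;> simp
  have h2 := (h1.smul (ContinuousLinearMap.fst ℂ (Cm m) ℂ).hasFDerivAt).restrictScalars ℝ
  refine h2.congr_fderiv (ContinuousLinearMap.ext fun P => ?_)
  simp [dprojV_apply, projMap, smul_smul, sub_eq_add_neg]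
  congr 1
  ring

lemma dproj_eq (z : AdS m) : dproj m z = dprojV (z : Vm m) :=
  (hasFDerivAt_projMap (AdS_snd_ne_zero z.2)).fderiv

/-- The horizontal lift of vectors of `ℂ^m` to `z ∈ AdS`: the vector `(z_{m+1} X, 0)`, which
projects to `X`, is corrected by a complex multiple of `z`. -/
def hlift (z : Vm m) : Cm m →L[ℝ] Vm m :=
  (z.2 • ContinuousLinearMap.inl ℂ (Cm m) ℂ +
    (z.2 • innerSL ℂ z.1).smulRight z).restrictScalars ℝ

lemma hlift_apply (z : Vm m) (X : Cm m) :
    hlift z X = z.2 • ((X, 0) : Vm m) + (z.2 * inner ℂ z.1 X) • z := rfl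

lemma hlift_csmul (z : Vm m) (c : ℂ) (X : Cm m) : hlift z (c • X) = c • hlift z X := by
  have h : ((c • X, 0) : Vm m) = c • ((X, 0) : Vm m) := by simp
  simp only [hlift_apply, inner_smul_right, h, smul_add, smul_smul]
  ring_nf

lemma dprojV_self {z : Vm m} (hz : z ∈ AdS m) : dprojV z z = 0 := by
  rw [dprojV_apply, ← fst_eq_smul_projMap (AdS_snd_ne_zero hz), sub_self, smul_zero]

lemma dprojV_hlift {z : Vm m} (hz : z ∈ AdS m) (X : Cm m) : dprojV z (hlift z X) = X := by
  rw [hlift_apply, map_add, dprojV_csmul, dprojV_csmul, dprojV_self hz, smul_zero, add_zero,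
    dprojV_apply]
  simp [smul_smul, AdS_snd_ne_zero hz]

lemma herm_hlift {z : Vm m} (hz : z ∈ AdS m) (X : Cm m) : herm z (hlift z X) = 0 := by
  rw [hlift_apply, herm_add_right, herm_csmul_right, herm_csmul_right, herm_self hz]
  simp [herm]

/-- The horizontal part of a vector `P` is `P + h(z, P) z`, since `h(z, z) = -1`. -/
lemma hlift_dprojV {z : Vm m} (hz : z ∈ AdS m) (P : Vm m) :
    hlift z (dprojV z P) = P + herm z P • z := by
  have h0 := AdS_snd_ne_zero hz
  have h1 : z.2 • ((dprojV z P, 0) : Vm m) = P - (P.2 * z.2⁻¹) • z := by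
    refine Prod.ext ?_ ?_
    · simp [dprojV_apply, smul_smul, h0, projMap]
    · simp [h0]
  have h2 : z.2 * inner ℂ z.1 (dprojV z P) = herm z (z.2 • ((dprojV z P, 0) : Vm m)) := by
    simp [herm]
  rw [hlift_apply, h2, h1, sub_eq_add_neg P, herm_add_right, ← neg_smul, herm_csmul_right,
    herm_self hz]
  module

lemma metricCH_apply (w X Y : Cm m) : metricCH m w X Y = (1 - ‖w‖ ^ 2)⁻¹ * (inner ℂ X Y).re +
    ((1 - ‖w‖ ^ 2) ^ 2)⁻¹ * (conj (inner ℂ w X) * inner ℂ w Y).re := by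
  have h : (innerSL ℝ : Bil (Cm m)) X Y = (inner ℂ X Y).re := real_inner_eq X Y
  have h' : (innerSL ℝ : Bil ℂ) (inner ℂ w X) (inner ℂ w Y) =
      (conj (inner ℂ w X) * inner ℂ w Y).re := by rw [mul_comm]; rfl
  rw [← h, ← h']
  rfl

/-- The horizontal lift is adjoint to the differential of the projection. -/
lemma mink_hlift {z : Vm m} (hz : z ∈ AdS m) (X : Cm m) (Q : Vm m) :
    mink m (hlift z X) Q = metricCH m (projMap m z) X (dprojV z Q) := by
  set Y := dprojV z Q
  set w := projMap m z
  have h1 : herm (hlift z X) Q = herm (hlift z X) (hlift z Y) := by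
    rw [hlift_dprojV hz, herm_add_right, herm_csmul_right, ← herm_conj z, herm_hlift hz]
    simp
  have h2 : herm (hlift z X) (hlift z Y) = herm (hlift z X) (z.2 • ((Y, 0) : Vm m)) := by
    rw [hlift_apply z Y, herm_add_right, herm_csmul_right (z.2 * _), ← herm_conj z, herm_hlift hz]
    simp
  have h3 : herm (hlift z X) (z.2 • ((Y, 0) : Vm m)) =
      (conj z.2 * z.2) * inner ℂ X Y +
        (conj z.2 * z.2) ^ 2 * (conj (inner ℂ w X) * inner ℂ w Y) := by
    rw [herm_csmul_right, ← herm_conj]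
    rw [hlift_apply, herm_add_right, herm_csmul_right, herm_csmul_right]
    have h4 : z.1 = z.2 • w := fst_eq_smul_projMap (AdS_snd_ne_zero hz)
    simp only [herm, h4, inner_smul_left, inner_smul_right]
    simp
    ring
  rw [mink_eq, h1, h2, h3, conj_mul_snd hz, metricCH_apply, ← Complex.ofReal_pow, Complex.add_re,
    Complex.re_ofReal_mul, Complex.re_ofReal_mul, inv_pow]

lemma metricCH_symm (w X Y : Cm m) : metricCH m w X Y = metricCH m w Y X := by
  rw [metricCH_apply, metricCH_apply, ← inner_conj_symm X Y]
  simp only [Complex.conj_re, Complex.mul_re, Complex.conj_im]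
  ring

lemma metricCH_J (w X Y : Cm m) :
    metricCH m w (mulI (Cm m) X) Y = -metricCH m w X (mulI (Cm m) Y) := by
  simp only [metricCH_apply, mulI_apply, inner_smul_left, inner_smul_right]
  simp
  ring

lemma metricCH_nondegenerate {w : Cm m} (hw : w ∈ CH m) (X : Cm m)
    (h : ∀ Y, metricCH m w X Y = 0) : X = 0 := by
  have h1 := h X
  have h0 := CH_pos hw
  rw [metricCH_apply, inner_self_eq_norm_sq_to_K, mul_comm (conj _), Complex.mul_conj] at h1
  have h2 : 0 ≤ ((1 - ‖w‖ ^ 2) ^ 2)⁻¹ * ((Complex.normSq (inner ℂ w X) : ℝ) : ℂ).re := by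
    rw [Complex.ofReal_re]
    have := Complex.normSq_nonneg (inner ℂ w X)
    positivity
  have h3 : (1 - ‖w‖ ^ 2)⁻¹ * ‖X‖ ^ 2 ≤ 0 := by
    have : (((‖X‖ : ℝ) : ℂ) ^ 2).re = ‖X‖ ^ 2 := by rw [← Complex.ofReal_pow, Complex.ofReal_re]
    have h4 : (((RCLike.ofReal ‖X‖ : ℂ)) ^ 2).re = ‖X‖ ^ 2 := this
    rw [h4] at h1
    linarith
  have h5 : ‖X‖ ^ 2 ≤ 0 := by
    by_contra hc
    push Not at hc
    have : 0 < (1 - ‖w‖ ^ 2)⁻¹ * ‖X‖ ^ 2 := by positivity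
    linarith
  have : ‖X‖ = 0 := by nlinarith [norm_nonneg X]
  exact norm_eq_zero.1 this

lemma mink_isInvertible : (mink m).IsInvertible := isInvertible_of_nondegenerate mink_nondegenerate

lemma metricCH_isInvertible {w : Cm m} (hw : w ∈ CH m) : (metricCH m w).IsInvertible :=
  isInvertible_of_nondegenerate (metricCH_nondegenerate hw)

/-- The section `w ↦ (w, 1) / √(1 - |w|²)` of the circle bundle `π`. -/
def sec (w : Cm m) : Vm m := ((√(1 - ‖w‖ ^ 2))⁻¹ : ℝ) • ((w, 1) : Vm m)

lemma sec_mem {w : Cm m} (hw : w ∈ CH m) : sec w ∈ AdS m := by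
  have h := CH_pos hw
  have h1 : (√(1 - ‖w‖ ^ 2)) ^ 2 = 1 - ‖w‖ ^ 2 := Real.sq_sqrt h.le
  change mink m (sec w) (sec w) = -1
  rw [mink_self, sec, Prod.smul_fst, Prod.smul_snd, norm_smul, norm_smul, mul_pow, mul_pow,
    Real.norm_eq_abs, sq_abs, inv_pow, h1]
  have h2 : ‖((w, 1) : Vm m).2‖ = 1 := norm_one
  rw [h2]
  field_simp
  ring

lemma projMap_sec {w : Cm m} (hw : w ∈ CH m) : projMap m (sec w) = w := by
  have h : √(1 - ‖w‖ ^ 2) ≠ 0 := (Real.sqrt_pos.2 (CH_pos hw)).ne'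
  have h1 : sec w = (((√(1 - ‖w‖ ^ 2))⁻¹ : ℝ) : ℂ) • ((w, 1) : Vm m) := by
    rw [Complex.coe_smul]; rfl
  rw [projMap, h1]
  simp [smul_smul, h]

/-- The section `sec` as a map between the subsets. -/
def secAdS (w : CH m) : AdS m := ⟨sec w, sec_mem w.2⟩

lemma proj_secAdS (w : CH m) : proj m (secAdS w) = w := Subtype.ext (projMap_sec w.2)

lemma projMap_csmul {c : ℂ} (hc : c ≠ 0) (z : Vm m) : projMap m (c • z) = projMap m z := by
  simp [projMap, smul_smul, mul_comm, hc]

lemma dprojV_csmul_csmul {c : ℂ} (hc : c ≠ 0) (z P : Vm m) :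
    dprojV (c • z) (c • P) = dprojV z P := by
  rw [dprojV_csmul, dprojV_apply, dprojV_apply, projMap_csmul hc, smul_smul]
  congr 1
  simp only [Prod.smul_snd, smul_eq_mul]
  field_simp

lemma herm_circle (c : Circle) (z P : Vm m) : herm ((c : ℂ) • z) ((c : ℂ) • P) = herm z P := by
  rw [herm_csmul_left, herm_csmul_right, ← mul_assoc, ← Complex.normSq_eq_conj_mul_self]
  simp

lemma proj_eq_iff (z z' : AdS m) :
    proj m z = proj m z' ↔ ∃ c : Circle, (z' : Vm m) = (c : ℂ) • (z : Vm m) := by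
  constructor
  · intro h
    have h1 : projMap m z = projMap m z' := congrArg Subtype.val h
    have h0 := AdS_snd_ne_zero z.2
    have h2 : ‖(z' : Vm m).2‖ = ‖(z : Vm m).2‖ := by
      have := AdS_norm_snd z'.2
      rw [← h1, ← AdS_norm_snd z.2] at this
      exact (sq_eq_sq₀ (norm_nonneg _) (norm_nonneg _)).1 this
    -- The unit complex number is the ratio of the last coordinates.
    refine ⟨⟨(z' : Vm m).2 / (z : Vm m).2, ?_⟩, ?_⟩
    · rw [Submonoid.unitSphere, Submonoid.mem_mk, Subsemigroup.mem_mk, mem_sphere_zero_iff_norm,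
        norm_div, h2, div_self (norm_ne_zero_iff.2 h0)]
    · refine Prod.ext ?_ ?_
      · rw [fst_eq_smul_projMap (AdS_snd_ne_zero z'.2), ← h1]
        simp [projMap, smul_smul, div_eq_mul_inv]
      · simp [h0]
  · rintro ⟨c, hc⟩
    refine Subtype.ext ?_
    change projMap m z = projMap m z'
    rw [hc, projMap_csmul c.coe_ne_zero]

lemma mem_horizontal {z : AdS m} {H : Vm m} : H ∈ horizontal m z ↔ herm (z : Vm m) H = 0 := by
  rw [horizontal, Set.mem_ofPred_eq, mulI_apply, mink_I_left, mink_eq, Complex.ext_iff]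
  rfl

lemma hlift_dprojV_of_horizontal {z : AdS m} {H : Vm m} (hH : H ∈ horizontal m z) :
    hlift (z : Vm m) (dprojV (z : Vm m) H) = H := by
  rw [hlift_dprojV z.2, mem_horizontal.1 hH, zero_smul, add_zero]

lemma bijOn_dproj (z : AdS m) : Set.BijOn (dproj m z) (horizontal m z) Set.univ := by
  rw [dproj_eq]
  refine ⟨fun _ _ => trivial, fun H hH K hK h => ?_, fun X _ => ?_⟩
  · rw [← hlift_dprojV_of_horizontal hH, h, hlift_dprojV_of_horizontal hK]
  · have h : hlift (z : Vm m) X ∈ horizontal m z := mem_horizontal.2 (herm_hlift z.2 X)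
    exact ⟨_, h, dprojV_hlift z.2 X⟩

lemma metricCH_dproj {z : AdS m} {H : Vm m} (hH : H ∈ horizontal m z) (K : Vm m) :
    metricCH m (proj m z) (dproj m z H) (dproj m z K) = mink m H K := by
  rw [dproj_eq]
  have h := mink_hlift z.2 (dprojV (z : Vm m) H) K
  rw [hlift_dprojV_of_horizontal hH] at h
  exact h.symm

end Geometry

/-! ### The Levi-Civita connection of complex hyperbolic space -/

section LeviCivita

open scoped ComplexConjugate

/-- For an invertible metric the Koszul formula determines the Christoffel symbol, so the choice in
`christoffel` returns any solution that is at hand. -/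
lemma christoffel_eq {F : Type*} [NormedAddCommGroup F] [NormedSpace ℝ F] {g : F → Bil F}
    {w X : F} (hg : (g w).IsInvertible) {A : F →L[ℝ] F}
    (hA : ∀ Y Z : F, 2 * g w (A Y) Z =
      fderiv ℝ (fun x => g x Y Z) w X + fderiv ℝ (fun x => g x X Z) w Y
        - fderiv ℝ (fun x => g x X Y) w Z) : christoffel g w X = A := by
  have h := Classical.epsilon_spec (p := fun A : F →L[ℝ] F => ∀ Y Z : F, 2 * g w (A Y) Z =
    fderiv ℝ (fun x => g x Y Z) w X + fderiv ℝ (fun x => g x X Z) w Y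
      - fderiv ℝ (fun x => g x X Y) w Z) ⟨A, hA⟩
  refine ContinuousLinearMap.ext fun Y => hg.injective (ContinuousLinearMap.ext fun Z => ?_)
  have h1 := (h Y Z).trans (hA Y Z).symm
  exact mul_left_cancel₀ two_ne_zero h1

variable {m : ℕ}

lemma norm_sq_line (w X : Cm m) (s : ℝ) :
    ‖w + s • X‖ ^ 2 = ‖w‖ ^ 2 + 2 * s * (inner ℂ w X).re + s ^ 2 * ‖X‖ ^ 2 := by
  rw [norm_add_sq_real, real_inner_smul_right, real_inner_eq, norm_smul, mul_pow,
    Real.norm_eq_abs, sq_abs]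
  ring

/-- The derivative of the metric, computed along the line `s ↦ w + s X`. -/
lemma fderiv_metricCH {w : Cm m} (hw : w ∈ CH m) (X Y Z : Cm m) :
    fderiv ℝ (fun x => metricCH m x Y Z) w X =
      2 * (inner ℂ w X).re * ((1 - ‖w‖ ^ 2)⁻¹) ^ 2 * (inner ℂ Y Z).re +
      4 * (inner ℂ w X).re * ((1 - ‖w‖ ^ 2)⁻¹) ^ 3 * (conj (inner ℂ w Y) * inner ℂ w Z).re +
      ((1 - ‖w‖ ^ 2)⁻¹) ^ 2 *
        (conj (inner ℂ X Y) * inner ℂ w Z + conj (inner ℂ w Y) * inner ℂ X Z).re := by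
  have h0 := (CH_pos hw).ne'
  have hdiff : DifferentiableAt ℝ (fun x => metricCH m x Y Z) w := by
    have hn : DifferentiableAt ℝ (fun x : Cm m => 1 - ‖x‖ ^ 2) w :=
      (differentiableAt_const _).sub (differentiableAt_id.norm_sq ℝ)
    have hi : ∀ V : Cm m, DifferentiableAt ℝ (fun x : Cm m => inner ℂ x V) w := fun V =>
      differentiableAt_id.inner ℂ (differentiableAt_const V)
    have hr : ∀ f : Cm m → ℂ, DifferentiableAt ℝ f w → DifferentiableAt ℝ (fun x => (f x).re) w :=
      fun f hf => Complex.reCLM.differentiableAt.comp w hf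
    have hc : ∀ f : Cm m → ℂ, DifferentiableAt ℝ f w →
        DifferentiableAt ℝ (fun x => conj (f x)) w :=
      fun f hf => Complex.conjCLE.differentiableAt.comp w hf
    simp only [metricCH_apply]
    exact ((hn.inv h0).mul_const _).add
      (((hn.pow 2).inv (pow_ne_zero 2 h0)).mul (hr _ ((hc _ (hi Y)).mul (hi Z))))
  have hN : HasDerivAt (fun s : ℝ => 1 - ‖w + s • X‖ ^ 2) (-(2 * (inner ℂ w X).re)) 0 := by
    simp only [norm_sq_line]
    have h1 := (((hasDerivAt_id (0 : ℝ)).const_mul 2).mul_const (inner ℂ w X).re)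
    have h2 := ((hasDerivAt_id (0 : ℝ)).pow 2).mul_const (‖X‖ ^ 2)
    refine (((h1.const_add (‖w‖ ^ 2)).add h2).const_sub 1).congr_deriv ?_
    simp
  have hi : ∀ V : Cm m, HasDerivAt (fun s : ℝ => inner ℂ (w + s • X) V) (inner ℂ X V) 0 := by
    intro V
    have h1 : HasDerivAt (fun s : ℝ => w + s • X) X 0 := by
      simpa using ((hasDerivAt_id (0 : ℝ)).smul_const X).const_add w
    refine (h1.inner ℂ (hasDerivAt_const (0 : ℝ) V)).congr_deriv ?_
    simp
  have hconj : HasDerivAt (fun s : ℝ => conj (inner ℂ (w + s • X) Y)) (conj (inner ℂ X Y)) 0 :=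
    Complex.conjCLE.hasFDerivAt.comp_hasDerivAt (0 : ℝ) (hi Y)
  have hre : HasDerivAt (fun s : ℝ => (conj (inner ℂ (w + s • X) Y) * inner ℂ (w + s • X) Z).re)
      (conj (inner ℂ X Y) * inner ℂ w Z + conj (inner ℂ w Y) * inner ℂ X Z).re 0 := by
    refine (Complex.reCLM.hasFDerivAt.comp_hasDerivAt (0 : ℝ) (hconj.mul (hi Z))).congr_deriv ?_
    simp
  have h0' : 1 - ‖w + (0 : ℝ) • X‖ ^ 2 ≠ 0 := by simpa using h0
  have hline := (((hN.fun_inv h0').mul_const (inner ℂ Y Z).re).fun_add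
    (((hN.fun_pow 2).fun_inv (pow_ne_zero 2 h0')).fun_mul hre)).congr_of_eventuallyEq
      (Filter.Eventually.of_forall fun s => metricCH_apply (w + s • X) Y Z)
  have hl : HasLineDerivAt ℝ (fun x => metricCH m x Y Z) _ w X := hline
  rw [← hdiff.lineDeriv_eq_fderiv, hl.lineDeriv]
  simp only [zero_smul, add_zero]
  field_simp
  ring

/-- The Christoffel symbols `Γ_w(X, Y) = (⟨w, X⟩ Y + ⟨w, Y⟩ X) / (1 - |w|²)` of `ℂH^m`. -/
def gammaCH (w X : Cm m) : Cm m →L[ℝ] Cm m :=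
  (((1 - ‖w‖ ^ 2)⁻¹ : ℝ) : ℂ) • (inner ℂ w X • ContinuousLinearMap.id ℂ (Cm m) +
    (innerSL ℂ w).smulRight X).restrictScalars ℝ

lemma gammaCH_apply (w X Y : Cm m) : gammaCH w X Y =
    (((1 - ‖w‖ ^ 2)⁻¹ : ℝ) : ℂ) • (inner ℂ w X • Y + inner ℂ w Y • X) := rfl

lemma gammaCH_csmul (w X : Cm m) (c : ℂ) (Y : Cm m) : gammaCH w X (c • Y) = c • gammaCH w X Y := by
  simp only [gammaCH_apply, inner_smul_right]
  module

lemma christoffel_metricCH {w : Cm m} (hw : w ∈ CH m) (X : Cm m) :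
    christoffel (metricCH m) w X = gammaCH w X := by
  refine christoffel_eq (metricCH_isInvertible hw) fun Y Z => ?_
  have h0 := (CH_pos hw).ne'
  rw [fderiv_metricCH hw, fderiv_metricCH hw, fderiv_metricCH hw, metricCH_apply, gammaCH_apply,
    ← inner_conj_symm X Y, ← inner_conj_symm X Z, ← inner_conj_symm Y Z]
  simp only [inner_smul_left, inner_smul_right, inner_add_left, inner_add_right]
  rw [← inner_conj_symm X Z, ← inner_conj_symm Y Z]
  -- Both sides are now polynomials in the inner products and in `(1 - |w|²)⁻¹`.
  generalize inner ℂ w X = a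
  generalize inner ℂ w Y = b
  generalize inner ℂ w Z = c
  generalize inner ℂ Y X = p
  generalize inner ℂ Z X = q
  generalize inner ℂ Z Y = r
  rw [← inv_pow]
  generalize (1 - ‖w‖ ^ 2)⁻¹ = k
  simp
  ring

end LeviCivita

/-! ### Derivatives in tangent directions -/

section Curves

variable {m : ℕ}

/-- The derivative of a map on a subset is computed along any curve in the subset. -/
lemma hasDerivAt_extZero_comp {F W : Type*} [NormedAddCommGroup F] [NormedSpace ℝ F]
    [NormedAddCommGroup W] [NormedSpace ℝ W] {S : Set F} {f : S → W} (x : S)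
    (hf : DifferentiableWithinAt ℝ (extZero f) S x) {γ : ℝ → F} {X : F} (h0 : γ 0 = x)
    (hγ : HasDerivAt γ X 0) (hS : ∀ᶠ s in nhds 0, γ s ∈ S) :
    HasDerivAt (fun s => extZero f (γ s)) (dirDeriv f x X) 0 := by
  have h := hf.hasFDerivWithinAt
  rw [← h0] at h
  have h1 := h.comp_hasDerivAt (0 : ℝ) hγ hS
  rw [h0] at h1
  exact h1

/-- Every horizontal vector is the velocity of a curve in `AdS`. -/
lemma exists_curve {z H : Vm m} (hz : z ∈ AdS m) (hH : herm z H = 0) :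
    ∃ γ : ℝ → Vm m, γ 0 = z ∧ HasDerivAt γ H 0 ∧ ∀ᶠ s in nhds 0, γ s ∈ AdS m := by
  set q := mink m H H with hq
  have hzz : mink m z z = -1 := hz
  have hzH : mink m z H = 0 := by rw [mink_eq, hH, Complex.zero_re]
  -- The curve is the line `z + s H`, rescaled so that it stays in `AdS`.
  refine ⟨fun s => (√(1 - s ^ 2 * q))⁻¹ • (z + s • H), by simp, ?_, ?_⟩
  · have h1 : HasDerivAt (fun s : ℝ => 1 - s ^ 2 * q) 0 0 := by
      refine ((((hasDerivAt_id (0 : ℝ)).pow 2).mul_const q).const_sub 1).congr_deriv ?_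
      simp
    have h2 : HasDerivAt (fun s : ℝ => (√(1 - s ^ 2 * q))⁻¹) 0 0 := by
      refine ((h1.sqrt (by simp)).fun_inv (by simp)).congr_deriv ?_
      simp
    have h3 : HasDerivAt (fun s : ℝ => z + s • H) H 0 := by
      simpa using ((hasDerivAt_id (0 : ℝ)).smul_const H).const_add z
    refine (h2.smul h3).congr_deriv ?_
    simp
  · have hc : ContinuousAt (fun s : ℝ => 1 - s ^ 2 * q) 0 := by fun_prop
    have hpos : ∀ᶠ s in nhds (0 : ℝ), 0 < 1 - s ^ 2 * q :=
      hc.eventually (lt_mem_nhds (by simp))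
    filter_upwards [hpos] with s hs
    change mink m _ _ = -1
    have h1 : √(1 - s ^ 2 * q) ^ 2 = 1 - s ^ 2 * q := Real.sq_sqrt hs.le
    have h2 : mink m (z + s • H) (z + s • H) = -(1 - s ^ 2 * q) := by
      simp only [map_add, map_smul, add_apply, smul_apply, smul_eq_mul, hzz,
        hzH, mink_symm H z, ← hq]
      ring
    simp only [map_smul, smul_apply, h2, smul_eq_mul]
    have : √(1 - s ^ 2 * q) ≠ 0 := (Real.sqrt_pos.2 hs).ne'
    field_simp
    exact congrArg Neg.neg h1.symm

lemma hasDerivAt_projMap_comp {z H : Vm m} (hz : z ∈ AdS m) {γ : ℝ → Vm m} (h0 : γ 0 = z)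
    (hγ : HasDerivAt γ H 0) : HasDerivAt (fun s => projMap m (γ s)) (dprojV z H) 0 := by
  have h := hasFDerivAt_projMap (AdS_snd_ne_zero hz)
  rw [← h0] at h
  have := h.comp_hasDerivAt (0 : ℝ) hγ
  rw [h0] at this
  exact this

open scoped ComplexConjugate in
/-- The second derivative of the projection in a horizontal direction is given by the Christoffel
symbols, up to a term in the vertical component. -/
lemma hasDerivAt_dprojV_comp {z H : Vm m} (hz : z ∈ AdS m) (hH : herm z H = 0) {γ : ℝ → Vm m}
    (h0 : γ 0 = z) (hγ : HasDerivAt γ H 0) (P : Vm m) :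
    HasDerivAt (fun s => dprojV (γ s) P)
      (-gammaCH (projMap m z) (dprojV z H) (dprojV z P) + herm z P • dprojV z H) 0 := by
  have hz2 := AdS_snd_ne_zero hz
  have h1 : HasDerivAt (fun s => (γ s).2) H.2 0 :=
    (ContinuousLinearMap.snd ℝ (Cm m) ℂ).hasFDerivAt.comp_hasDerivAt (0 : ℝ) hγ
  have h2 : HasDerivAt (fun s => ((γ s).2)⁻¹) _ 0 := h1.fun_inv (by rw [h0]; exact hz2)
  have h3 := ((hasDerivAt_projMap_comp hz h0 hγ).fun_const_smul P.2).const_sub P.1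
  -- The last coordinate of a vector in terms of its projection and its vertical component.
  have key : ∀ Q : Vm m, z.2⁻¹ * Q.2 = (((1 - ‖projMap m z‖ ^ 2)⁻¹ : ℝ) : ℂ) *
      inner ℂ (projMap m z) (dprojV z Q) - herm z Q := by
    intro Q
    have h4 := congrArg Prod.snd (hlift_dprojV hz Q)
    rw [hlift_apply, fst_eq_smul_projMap hz2, inner_smul_left] at h4
    have h5 : z.2 * (conj z.2 * inner ℂ (projMap m z) (dprojV z Q)) * z.2 =
        Q.2 + herm z Q * z.2 := by simpa using h4
    have h6 : Q.2 = z.2 * ((conj z.2 * z.2) * inner ℂ (projMap m z) (dprojV z Q) - herm z Q) := by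
      linear_combination -h5
    rw [conj_mul_snd hz] at h6
    rw [h6, inv_mul_cancel_left₀ hz2]
  have hP := key P
  have hH' := key H
  rw [hH, sub_zero] at hH'
  refine (h2.smul h3).congr_deriv ?_
  rw [h0]
  have e1 : z.2⁻¹ • -(P.2 • dprojV z H) + (-H.2 / z.2 ^ 2) • (P.1 - P.2 • projMap m z) =
      -((z.2⁻¹ * P.2) • dprojV z H) - (z.2⁻¹ * H.2) • dprojV z P := by
    rw [dprojV_apply z P]
    have : -H.2 / z.2 ^ 2 = -(z.2⁻¹ * H.2 * z.2⁻¹) := by field_simp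
    rw [this]
    module
  rw [e1, hP, hH', gammaCH_apply]
  module

lemma hasDerivAt_herm_comp {H : Vm m} {γ : ℝ → Vm m}
    (hγ : HasDerivAt γ H 0) (P : Vm m) : HasDerivAt (fun s => herm (γ s) P) (herm H P) 0 := by
  have h1 : HasDerivAt (fun s => (γ s).1) H.1 0 :=
    (ContinuousLinearMap.fst ℝ (Cm m) ℂ).hasFDerivAt.comp_hasDerivAt (0 : ℝ) hγ
  have h2 : HasDerivAt (fun s => (γ s).2) H.2 0 :=
    (ContinuousLinearMap.snd ℝ (Cm m) ℂ).hasFDerivAt.comp_hasDerivAt (0 : ℝ) hγ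
  have h3 := h1.inner ℂ (hasDerivAt_const (0 : ℝ) P.1)
  have h4 := (Complex.conjCLE.hasFDerivAt.comp_hasDerivAt (0 : ℝ) h2).mul_const P.2
  refine (h3.sub h4).congr_deriv ?_
  simp [herm]

end Curves

/-! ### The bundle map `θ` and its inverse -/

section Theta

variable {m : ℕ}

/-- The value of `θ` at a pair of vectors, in terms of their projections and their vertical
components. -/
lemma theta_apply (z : AdS m) (e : Triple (Cm m)) (P Q : Vm m) :
    theta m z e ![P, Q] = contractL (Cm m) e.1 (dprojV (z : Vm m) P) (dprojV (z : Vm m) Q) +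
      e.2.2 * ((herm (z : Vm m) P).im * (herm (z : Vm m) Q).re -
        (herm (z : Vm m) P).re * (herm (z : Vm m) Q).im) +
      1 / 2 * ((herm (z : Vm m) P).re * e.2.1 (dprojV (z : Vm m) Q) -
        (herm (z : Vm m) Q).re * e.2.1 (dprojV (z : Vm m) P) -
        (herm (z : Vm m) P).im * e.2.1 (Complex.I • dprojV (z : Vm m) Q) +
        (herm (z : Vm m) Q).im * e.2.1 (Complex.I • dprojV (z : Vm m) P)) := by
  have h : (dprojV (z : Vm m)) ∘ ![P, Q] = ![dprojV (z : Vm m) P, dprojV (z : Vm m) Q] := by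
    ext i; fin_cases i <;> rfl
  simp only [theta, dproj_eq, ContinuousAlternatingMap.add_apply,
    ContinuousAlternatingMap.smul_apply, smul_eq_mul, wedge_apply, covJ_apply,
    ContinuousAlternatingMap.compContinuousLinearMap_apply, h, contractL_apply, mulI_apply,
    mink_I_left, ContinuousLinearMap.comp_apply, dprojV_csmul]
  simp only [mink_eq]
  ring

lemma theta_mem {z : AdS m} {e : Triple (Cm m)} (he : e ∈ FibreE (mulI (Cm m))) :
    theta m z e ∈ LambdaJ (mulI (Vm m)) := by
  rw [mem_LambdaJ]
  intro P Q
  have h := mem_LambdaJ.1 (FibreE_iff.1 he)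
  simp only [theta_apply, contractL_apply, dprojV_csmul, h, herm_csmul_right, smul_smul,
    Complex.I_mul_I, neg_smul, one_smul, map_neg]
  simp
  ring

lemma theta_add (z : AdS m) (e e' : Triple (Cm m)) :
    theta m z (e + e') = theta m z e + theta m z e' := by
  refine twoForm_ext fun P Q => ?_
  rw [ContinuousAlternatingMap.add_apply]
  simp only [theta_apply, Prod.fst_add, Prod.snd_add, map_add, add_apply]
  ring

lemma theta_smul (c : ℝ) (z : AdS m) (e : Triple (Cm m)) :
    theta m z (c • e) = c • theta m z e := by
  refine twoForm_ext fun P Q => ?_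
  rw [ContinuousAlternatingMap.smul_apply]
  simp only [theta_apply, Prod.smul_fst, Prod.smul_snd, map_smul, smul_apply, smul_eq_mul]
  ring

/-- The inverse of `θ_z`: the form `ξ` is the pull-back under the horizontal lift, while `α` and `u`
are the horizontal part of `-2 ι_ν φ` and the value of `φ` at `(Jν, ν)`. -/
def psi (z : Vm m) (φ : TwoForm (Vm m)) : Triple (Cm m) :=
  (φ.compContinuousLinearMap (hlift z), (-2 : ℝ) • (contractL (Vm m) φ z).comp (hlift z),
    φ ![Complex.I • z, z])

lemma psi_fst_apply (z : Vm m) (φ : TwoForm (Vm m)) (X Y : Cm m) :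
    (psi z φ).1 ![X, Y] = φ ![hlift z X, hlift z Y] := by
  have h : (hlift z) ∘ ![X, Y] = ![hlift z X, hlift z Y] := by
    ext i <;> fin_cases i <;> rfl
  exact congrArg φ h

lemma psi_snd_fst_apply (z : Vm m) (φ : TwoForm (Vm m)) (X : Cm m) :
    (psi z φ).2.1 X = -2 * φ ![z, hlift z X] := by
  simp [psi]

/-- This holds for all triples, whether or not they are `J`-invariant. -/
lemma psi_theta (z : AdS m) (e : Triple (Cm m)) : psi (z : Vm m) (theta m z e) = e := by
  refine Prod.ext (twoForm_ext fun X Y => ?_) (Prod.ext (ContinuousLinearMap.ext fun X => ?_) ?_)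
  · rw [psi_fst_apply, theta_apply]
    simp [dprojV_hlift z.2, herm_hlift z.2]
  · rw [psi_snd_fst_apply, theta_apply]
    simp only [dprojV_hlift z.2, herm_hlift z.2, herm_self z.2, dprojV_self z.2]
    simp
  · change theta m z e ![Complex.I • (z : Vm m), z] = _
    rw [theta_apply]
    simp only [herm_self z.2, dprojV_self z.2, herm_csmul_right, dprojV_csmul]
    simp

lemma theta_psi (z : AdS m) {φ : TwoForm (Vm m)} (hφ : φ ∈ LambdaJ (mulI (Vm m))) :
    theta m z (psi (z : Vm m) φ) = φ := by
  refine twoForm_ext fun P Q => ?_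
  -- Split `P` and `Q` into horizontal and vertical parts and expand `φ(P, Q)`.
  rw [theta_apply, contractL_apply, psi_fst_apply]
  simp only [psi_snd_fst_apply, hlift_csmul]
  set P' := hlift (z : Vm m) (dprojV (z : Vm m) P) with hP'
  set Q' := hlift (z : Vm m) (dprojV (z : Vm m) Q) with hQ'
  set a := herm (z : Vm m) P with ha
  set b := herm (z : Vm m) Q with hb
  have hP : P = P' - a • (z : Vm m) := by rw [hP', hlift_dprojV z.2]; abel
  have hQ : Q = Q' - b • (z : Vm m) := by rw [hQ', hlift_dprojV z.2]; abel
  change φ ![P', Q'] + φ ![Complex.I • (z : Vm m), z] * _ + _ = _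
  have h1 : φ ![Complex.I • (z : Vm m), P'] = -φ ![z, Complex.I • P'] := LambdaJ_I_left hφ _ _
  have h2 : φ ![Complex.I • (z : Vm m), Q'] = -φ ![z, Complex.I • Q'] := LambdaJ_I_left hφ _ _
  have h3 : φ ![z, Complex.I • (z : Vm m)] = -φ ![Complex.I • (z : Vm m), z] := form_swap _ _ _
  rw [hP, hQ, form_sub_left, form_sub_right, form_sub_right,
    form_swap φ (b • (z : Vm m)) P']
  rw [form_csmul_left φ b, form_csmul_left φ a _ Q', form_csmul_left φ a _ (b • (z : Vm m)),
    form_csmul_right φ b (z : Vm m), form_csmul_right φ b (Complex.I • (z : Vm m)), h1, h2, h3,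
    form_self, form_self]
  ring

lemma psi_mem (z : Vm m) {φ : TwoForm (Vm m)} (hφ : φ ∈ LambdaJ (mulI (Vm m))) :
    psi z φ ∈ FibreE (mulI (Cm m)) := by
  rw [FibreE_iff, mem_LambdaJ]
  intro X Y
  rw [psi_fst_apply, psi_fst_apply, hlift_csmul, hlift_csmul, mem_LambdaJ.1 hφ]

/-- The isomorphism `Ψ_z = θ_z⁻¹`. -/
def Psi (z : AdS m) : LambdaJ (mulI (Vm m)) ≃ₗ[ℝ] FibreE (mulI (Cm m)) :=
  LinearEquiv.symm
    { toFun := fun e => ⟨theta m z e.1, theta_mem e.2⟩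
      invFun := fun φ => ⟨psi (z : Vm m) φ.1, psi_mem (z : Vm m) φ.2⟩
      map_add' := fun e e' => Subtype.ext (theta_add z e.1 e'.1)
      map_smul' := fun c e => Subtype.ext (theta_smul c z e.1)
      left_inv := fun e => Subtype.ext (psi_theta z e.1)
      right_inv := fun φ => Subtype.ext (theta_psi z φ.2) }

lemma coe_Psi_symm (z : AdS m) (e : FibreE (mulI (Cm m))) :
    ((Psi z).symm e : TwoForm (Vm m)) = theta m z e := rfl

lemma coe_Psi (z : AdS m) (φ : LambdaJ (mulI (Vm m))) :
    (Psi z φ : Triple (Cm m)) = psi (z : Vm m) φ := rfl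

lemma theta_circle {c : Circle} {z z' : AdS m} (h : (z' : Vm m) = (c : ℂ) • (z : Vm m))
    (e : Triple (Cm m)) (P Q : Vm m) :
    theta m z' e ![(c : ℂ) • P, (c : ℂ) • Q] = theta m z e ![P, Q] := by
  rw [theta_apply, theta_apply, h]
  simp only [herm_circle, dprojV_csmul_csmul c.coe_ne_zero]

/-- The circle preserves each `J`-invariant form. -/
lemma LambdaJ_circle {φ : TwoForm (Vm m)} (hφ : φ ∈ LambdaJ (mulI (Vm m))) (c : Circle)
    (P Q : Vm m) : φ ![(c : ℂ) • P, (c : ℂ) • Q] = φ ![P, Q] := by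
  have h : (c : ℂ).re ^ 2 + (c : ℂ).im ^ 2 = 1 := by
    have := Circle.normSq_coe c
    rw [Complex.normSq_apply] at this
    linarith
  rw [LambdaJ_csmul hφ, h, one_mul]

/-- On `J`-invariant data `θ` only depends on the image of the point in `ℂH^m`. -/
lemma theta_congr {z z' : AdS m} (h : proj m z = proj m z') {e : Triple (Cm m)}
    (he : e ∈ FibreE (mulI (Cm m))) : theta m z e = theta m z' e := by
  obtain ⟨c, hc⟩ := (proj_eq_iff z z').1 h
  refine twoForm_ext fun P Q => ?_
  rw [← theta_circle hc, LambdaJ_circle (theta_mem he)]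

lemma psi_congr {z z' : AdS m} (h : proj m z = proj m z') {φ : TwoForm (Vm m)}
    (hφ : φ ∈ LambdaJ (mulI (Vm m))) : psi (z : Vm m) φ = psi (z' : Vm m) φ := by
  rw [← psi_theta z' (psi (z : Vm m) φ), ← theta_congr h (psi_mem _ hφ), theta_psi z hφ]

lemma Psi_circle (c : Circle) (z z' : AdS m) (h : (z' : Vm m) = (c : ℂ) • (z : Vm m))
    (φ φ' : LambdaJ (mulI (Vm m)))
    (hφ : ∀ X Y : Vm m, φ'.1 ![(c : ℂ) • X, (c : ℂ) • Y] = φ.1 ![X, Y]) :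
    Psi z' φ' = Psi z φ := by
  have h1 : φ' = φ := Subtype.ext (twoForm_ext fun X Y => by
    rw [← hφ, LambdaJ_circle φ'.2])
  rw [h1]
  exact Subtype.ext (psi_congr ((proj_eq_iff z z').2 ⟨c, h⟩) φ.2).symm

end Theta

/-! ### Sections -/

section Sections

variable {m : ℕ}

lemma contDiffOn_projMap : ContDiffOn ℝ ∞ (projMap m) (AdS m) := by
  have h2 : ContDiffOn ℝ ∞ (fun z : Vm m => z.2⁻¹) (AdS m) :=
    contDiff_snd.contDiffOn.inv fun z hz => AdS_snd_ne_zero hz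
  exact h2.smul contDiff_fst.contDiffOn

lemma mapsTo_projMap : Set.MapsTo (projMap m) (AdS m) (CH m) := fun _ hz => projMap_mem hz

lemma contDiffOn_dprojV (P : Vm m) : ContDiffOn ℝ ∞ (fun z => dprojV z P) (AdS m) := by
  have h2 : ContDiffOn ℝ ∞ (fun z : Vm m => z.2⁻¹) (AdS m) :=
    contDiff_snd.contDiffOn.inv fun z hz => AdS_snd_ne_zero hz
  have h3 : ContDiffOn ℝ ∞ (fun z : Vm m => P.2 • projMap m z) (AdS m) :=
    contDiffOn_projMap.const_smul P.2
  exact h2.smul (contDiffOn_const.sub h3)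

lemma contDiff_herm (P : Vm m) : ContDiff ℝ ∞ (fun z => herm z P) :=
  (contDiff_fst.inner ℂ contDiff_const).sub
    ((Complex.conjCLE.contDiff.comp contDiff_snd).mul contDiff_const)

lemma contDiffOn_sec : ContDiffOn ℝ ∞ (sec (m := m)) (CH m) := by
  have h1 : ContDiffOn ℝ ∞ (fun w : Cm m => 1 - ‖w‖ ^ 2) (CH m) :=
    contDiffOn_const.sub (contDiff_norm_sq ℝ).contDiffOn
  have h2 : ContDiffOn ℝ ∞ (fun w : Cm m => (√(1 - ‖w‖ ^ 2))⁻¹) (CH m) :=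
    (h1.sqrt fun w hw => (CH_pos hw).ne').inv fun w hw => (Real.sqrt_pos.2 (CH_pos hw)).ne'
  exact h2.smul (contDiff_id.prodMk contDiff_const).contDiffOn

lemma contDiff_hlift (X : Cm m) : ContDiff ℝ ∞ (fun z : Vm m => hlift z X) := by
  simp only [hlift_apply]
  exact (contDiff_snd.smul contDiff_const).add
    ((contDiff_snd.mul (contDiff_fst.inner ℂ contDiff_const)).smul contDiff_id)

/-- The value of `pullSection` at a pair of vectors, as a map on the ambient space. -/
lemma extZero_pullSection_apply (σ : CH m → Triple (Cm m)) {z : Vm m} (hz : z ∈ AdS m)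
    (P Q : Vm m) : extZero (pullSection m σ) z ![P, Q] =
      contractL (Cm m) (extZero (fun w => (σ w).1) (projMap m z)) (dprojV z P) (dprojV z Q) +
      extZero (fun w => (σ w).2.2) (projMap m z) * ((herm z P).im * (herm z Q).re -
        (herm z P).re * (herm z Q).im) +
      1 / 2 * ((herm z P).re * extZero (fun w => (σ w).2.1) (projMap m z) (dprojV z Q) -
        (herm z Q).re * extZero (fun w => (σ w).2.1) (projMap m z) (dprojV z P) -
        (herm z P).im * extZero (fun w => (σ w).2.1) (projMap m z) (Complex.I • dprojV z Q) +
        (herm z Q).im * extZero (fun w => (σ w).2.1) (projMap m z) (Complex.I • dprojV z P)) := by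
  have h : ∀ {W : Type} [AddCommGroup W] (f : CH m → W),
      extZero f (projMap m z) = f (proj m ⟨z, hz⟩) := fun f => extZero_apply f (proj m ⟨z, hz⟩)
  rw [show extZero (pullSection m σ) z = pullSection m σ ⟨z, hz⟩ from
    extZero_apply (pullSection m σ) ⟨z, hz⟩, pullSection, theta_apply, h, h, h]

section Components

variable {σ : CH m → Triple (Cm m)}

lemma IsSmooth.comp_fst (hσ : IsSmooth σ) : IsSmooth fun w => (σ w).1 :=
  hσ.clm (ContinuousLinearMap.fst ℝ (TwoForm (Cm m)) ((Cm m →L[ℝ] ℝ) × ℝ))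

lemma IsSmooth.comp_snd_fst (hσ : IsSmooth σ) : IsSmooth fun w => (σ w).2.1 :=
  hσ.clm ((ContinuousLinearMap.fst ℝ (Cm m →L[ℝ] ℝ) ℝ).comp
    (ContinuousLinearMap.snd ℝ (TwoForm (Cm m)) ((Cm m →L[ℝ] ℝ) × ℝ)))

lemma IsSmooth.comp_snd_snd (hσ : IsSmooth σ) : IsSmooth fun w => (σ w).2.2 :=
  hσ.clm ((ContinuousLinearMap.snd ℝ (Cm m →L[ℝ] ℝ) ℝ).comp
    (ContinuousLinearMap.snd ℝ (TwoForm (Cm m)) ((Cm m →L[ℝ] ℝ) × ℝ)))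

end Components

lemma isSmooth_pullSection {σ : CH m → Triple (Cm m)} (hσ : IsSmooth σ) :
    IsSmooth (pullSection m σ) := by
  refine contDiffOn_twoForm fun P Q => ?_
  refine ContDiffOn.congr ?_ fun z hz => extZero_pullSection_apply σ hz P Q
  have hξ := contDiff_contractL.comp_contDiffOn
    (ContDiffOn.comp hσ.comp_fst contDiffOn_projMap mapsTo_projMap)
  have hα := ContDiffOn.comp hσ.comp_snd_fst contDiffOn_projMap mapsTo_projMap
  have hu := ContDiffOn.comp hσ.comp_snd_snd contDiffOn_projMap mapsTo_projMap
  have hre : ∀ R : Vm m, ContDiffOn ℝ ∞ (fun z => (herm z R).re) (AdS m) := fun R =>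
    (Complex.reCLM.contDiff.comp (contDiff_herm R)).contDiffOn
  have him : ∀ R : Vm m, ContDiffOn ℝ ∞ (fun z => (herm z R).im) (AdS m) := fun R =>
    (Complex.imCLM.contDiff.comp (contDiff_herm R)).contDiffOn
  have hI : ∀ R : Vm m, ContDiffOn ℝ ∞ (fun z => Complex.I • dprojV z R) (AdS m) := fun R =>
    (contDiffOn_dprojV R).const_smul Complex.I
  exact (((hξ.clm_apply (contDiffOn_dprojV P)).clm_apply (contDiffOn_dprojV Q)).add
    (hu.mul (((him P).mul (hre Q)).sub ((hre P).mul (him Q))))).add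
    (contDiffOn_const.mul
      (((((hre P).mul (hα.clm_apply (contDiffOn_dprojV Q))).sub
        ((hre Q).mul (hα.clm_apply (contDiffOn_dprojV P)))).sub
        ((him P).mul (hα.clm_apply (hI Q)))).add ((him Q).mul (hα.clm_apply (hI P)))))

/-- The section of `𝓔` obtained by restricting an invariant section to the image of `sec`. -/
def descend (Φ : AdS m → TwoForm (Vm m)) (w : CH m) : Triple (Cm m) :=
  psi (secAdS w : Vm m) (Φ (secAdS w))

lemma contDiffOn_extZero_sec {Φ : AdS m → TwoForm (Vm m)} (hΦ : IsSmooth Φ) :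
    ContDiffOn ℝ ∞ (fun w => contractL (Vm m) (extZero Φ (sec w))) (CH m) :=
  contDiff_contractL.comp_contDiffOn
    (ContDiffOn.comp hΦ contDiffOn_sec fun _ hw => sec_mem hw)

lemma isSmooth_descend {Φ : AdS m → TwoForm (Vm m)} (hΦ : IsSmooth Φ) :
    IsSmooth (descend Φ) := by
  have hΦs := contDiffOn_extZero_sec hΦ
  have hl : ∀ X : Cm m, ContDiffOn ℝ ∞ (fun w => hlift (sec w) X) (CH m) := fun X =>
    (contDiff_hlift X).comp_contDiffOn contDiffOn_sec
  have hext : ∀ w ∈ CH m, extZero (descend Φ) w = psi (sec w) (extZero Φ (sec w)) := by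
    intro w hw
    have h1 := extZero_apply (descend Φ) ⟨w, hw⟩
    have h2 := extZero_apply Φ (secAdS ⟨w, hw⟩)
    refine h1.trans ?_
    rw [descend, ← h2]
    rfl
  refine ContDiffOn.congr ?_ hext
  refine ContDiffOn.prodMk (contDiffOn_twoForm fun X Y => ?_) (ContDiffOn.prodMk ?_ ?_)
  · refine ((hΦs.clm_apply (hl X)).clm_apply (hl Y)).congr fun w _ => ?_
    exact (psi_fst_apply _ _ X Y).trans (contractL_apply _ _ _).symm
  · rw [contDiffOn_clm_apply]
    intro X
    have h : ContDiffOn ℝ ∞ (fun w => (-2 : ℝ) *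
        contractL (Vm m) (extZero Φ (sec w)) (sec w) (hlift (sec w) X)) (CH m) :=
      contDiffOn_const.mul ((hΦs.clm_apply contDiffOn_sec).clm_apply (hl X))
    refine h.congr fun w _ => ?_
    exact (psi_snd_fst_apply _ _ X).trans (by rw [contractL_apply])
  · have hI : ContDiffOn ℝ ∞ (fun w => Complex.I • sec w) (CH m) :=
      contDiffOn_sec.const_smul Complex.I
    refine ((hΦs.clm_apply hI).clm_apply contDiffOn_sec).congr fun w _ => ?_
    exact (contractL_apply _ _ _).symm

lemma pullSection_mem {σ : CH m → Triple (Cm m)} (hσ : σ ∈ SectionsE (mulI (Cm m)) (CH m)) :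
    pullSection m σ ∈ InvariantSections m := by
  refine ⟨isSmooth_pullSection hσ.1, fun z => theta_mem (hσ.2 _), fun c z z' h X Y => ?_⟩
  rw [pullSection, pullSection, ← (proj_eq_iff z z').2 ⟨c, h⟩, theta_circle h]

lemma descend_mem {Φ : AdS m → TwoForm (Vm m)} (hΦ : Φ ∈ InvariantSections m) :
    descend Φ ∈ SectionsE (mulI (Cm m)) (CH m) :=
  ⟨isSmooth_descend hΦ.1, fun _ => psi_mem _ (hΦ.2.1 _)⟩

lemma descend_pullSection (σ : CH m → Triple (Cm m)) : descend (pullSection m σ) = σ := by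
  funext w
  rw [descend, pullSection, psi_theta, proj_secAdS]

lemma pullSection_descend {Φ : AdS m → TwoForm (Vm m)} (hΦ : Φ ∈ InvariantSections m) :
    pullSection m (descend Φ) = Φ := by
  funext z
  have hp : proj m (secAdS (proj m z)) = proj m z := proj_secAdS _
  obtain ⟨c, hc⟩ := (proj_eq_iff _ _).1 hp
  have h1 : Φ (secAdS (proj m z)) = Φ z := twoForm_ext fun X Y => by
    rw [← hΦ.2.2 c _ _ hc, LambdaJ_circle (hΦ.2.1 z)]
  rw [pullSection, descend, h1, psi_congr hp (hΦ.2.1 z), theta_psi z (hΦ.2.1 z)]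

lemma pullSection_add (σ τ : CH m → Triple (Cm m)) :
    pullSection m (σ + τ) = pullSection m σ + pullSection m τ :=
  funext fun z => theta_add z _ _

lemma pullSection_smul (c : ℝ) (σ : CH m → Triple (Cm m)) :
    pullSection m (c • σ) = c • pullSection m σ :=
  funext fun z => theta_smul c z _

/-- The isomorphism `Ψ^*` at the level of smooth sections. -/
def sectionsEquiv : SectionsE (mulI (Cm m)) (CH m) ≃ₗ[ℝ] InvariantSections m where
  toFun σ := ⟨pullSection m σ, pullSection_mem σ.2⟩
  invFun Φ := ⟨descend Φ, descend_mem Φ.2⟩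
  map_add' σ τ := Subtype.ext (pullSection_add σ.1 τ.1)
  map_smul' c σ := Subtype.ext (pullSection_smul c σ.1)
  left_inv σ := Subtype.ext (descend_pullSection σ.1)
  right_inv Φ := Subtype.ext (pullSection_descend Φ.2)

end Sections

/-! ### The flat connection and the connection of complex hyperbolic space -/

section Connections

variable {m : ℕ}

lemma metricCH_dprojV {z : AdS m} {H : Vm m} (hH : H ∈ horizontal m z) (P : Vm m) :
    metricCH m (proj m z) (dprojV (z : Vm m) H) (dprojV (z : Vm m) P) =
      (herm H P).re := by
  rw [← mink_eq, ← metricCH_dproj hH, dproj_eq]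

lemma metricCH_I_dprojV {z : AdS m} {H : Vm m} (hH : H ∈ horizontal m z) (P : Vm m) :
    metricCH m (proj m z) (Complex.I • dprojV (z : Vm m) H) (dprojV (z : Vm m) P) =
      (herm H P).im := by
  have hIH : Complex.I • H ∈ horizontal m z := by
    rw [mem_horizontal, herm_csmul_right, mem_horizontal.1 hH, mul_zero]
  rw [← mink_I_left, ← metricCH_dproj hIH, dproj_eq, dprojV_csmul]

lemma hasDerivAt_clm_comp {V W : Type*} [NormedAddCommGroup V] [NormedSpace ℝ V]
    [NormedAddCommGroup W] [NormedSpace ℝ W] (L : V →L[ℝ] W) {f : ℝ → V} {f' : V} {t : ℝ}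
    (hf : HasDerivAt f f' t) : HasDerivAt (fun s => L (f s)) (L f') t :=
  L.hasFDerivAt.comp_hasDerivAt t hf

lemma hasDerivAt_form_apply {F : Type*} [NormedAddCommGroup F] [NormedSpace ℝ F]
    {ξ : ℝ → TwoForm F} {X Y : ℝ → F} {ξ' : TwoForm F} {X' Y' : F} {t : ℝ}
    (hξ : HasDerivAt ξ ξ' t) (hX : HasDerivAt X X' t) (hY : HasDerivAt Y Y' t) :
    HasDerivAt (fun s => contractL F (ξ s) (X s) (Y s))
      (contractL F ξ' (X t) (Y t) + contractL F (ξ t) X' (Y t) + contractL F (ξ t) (X t) Y') t := by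
  have h1 : HasDerivAt (fun s => contractL F (ξ s)) (contractL F ξ') t :=
    hasDerivAt_clm_comp (V := TwoForm F) (W := Bil F) (contractL F) hξ
  have h2 : HasDerivAt (fun s => contractL F (ξ s) (X s))
      (contractL F ξ' (X t) + contractL F (ξ t) X') t := HasDerivAt.clm_apply h1 hX
  exact h2.clm_apply hY

/-- The derivative of the expression of `theta_apply` along a curve. -/
lemma hasDerivAt_theta_formula {ξ : ℝ → TwoForm (Cm m)} {α : ℝ → Cm m →L[ℝ] ℝ} {u : ℝ → ℝ}
    {Y Z : ℝ → Cm m} {a b : ℝ → ℂ} {ξ' : TwoForm (Cm m)} {α' : Cm m →L[ℝ] ℝ} {u' : ℝ} {Y' Z' : Cm m}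
    {a' b' : ℂ} {t : ℝ} (hξ : HasDerivAt ξ ξ' t) (hα : HasDerivAt α α' t) (hu : HasDerivAt u u' t)
    (hY : HasDerivAt Y Y' t) (hZ : HasDerivAt Z Z' t) (ha : HasDerivAt a a' t)
    (hb : HasDerivAt b b' t) :
    HasDerivAt (fun s => contractL (Cm m) (ξ s) (Y s) (Z s) +
        u s * ((a s).im * (b s).re - (a s).re * (b s).im) +
        1 / 2 * ((a s).re * α s (Z s) - (b s).re * α s (Y s) -
          (a s).im * α s (Complex.I • Z s) + (b s).im * α s (Complex.I • Y s)))
      ((contractL (Cm m) ξ' (Y t) (Z t) + contractL (Cm m) (ξ t) Y' (Z t) +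
          contractL (Cm m) (ξ t) (Y t) Z') +
        (u' * ((a t).im * (b t).re - (a t).re * (b t).im) +
          u t * (a'.im * (b t).re + (a t).im * b'.re - (a'.re * (b t).im + (a t).re * b'.im))) +
        1 / 2 * ((a'.re * α t (Z t) + (a t).re * (α' (Z t) + α t Z')) -
          (b'.re * α t (Y t) + (b t).re * (α' (Y t) + α t Y')) -
          (a'.im * α t (Complex.I • Z t) +
            (a t).im * (α' (Complex.I • Z t) + α t (Complex.I • Z'))) +
          (b'.im * α t (Complex.I • Y t) +
            (b t).im * (α' (Complex.I • Y t) + α t (Complex.I • Y'))))) t := by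
  have hre : ∀ {c : ℝ → ℂ} {c' : ℂ}, HasDerivAt c c' t →
      HasDerivAt (fun s => (c s).re) c'.re t := fun hc =>
    Complex.reCLM.hasFDerivAt.comp_hasDerivAt t hc
  have him : ∀ {c : ℝ → ℂ} {c' : ℂ}, HasDerivAt c c' t →
      HasDerivAt (fun s => (c s).im) c'.im t := fun hc =>
    Complex.imCLM.hasFDerivAt.comp_hasDerivAt t hc
  have hIY : HasDerivAt (fun s => Complex.I • Y s) (Complex.I • Y') t :=
    hY.fun_const_smul Complex.I
  have hIZ : HasDerivAt (fun s => Complex.I • Z s) (Complex.I • Z') t :=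
    hZ.fun_const_smul Complex.I
  exact ((hasDerivAt_form_apply hξ hY hZ).fun_add
    (hu.fun_mul (((him ha).fun_mul (hre hb)).fun_sub ((hre ha).fun_mul (him hb))))).fun_add
    ((((((hre ha).fun_mul (hα.clm_apply hZ)).fun_sub
        ((hre hb).fun_mul (hα.clm_apply hY))).fun_sub
        ((him ha).fun_mul (hα.clm_apply hIZ))).fun_add
        ((him hb).fun_mul (hα.clm_apply hIY))).const_mul (1 / 2 : ℝ))

/-- The flat derivative of `Ψ^*σ` in a horizontal direction, computed along a curve. Here `X`, `Y`,
`Z` are the projections of `H`, `P`, `Q`, and `Y'`, `Z'` are the derivatives of the projections of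
`P` and `Q` along the curve; `ξ'`, `α'`, `u'` are the derivatives of the components of `σ`. -/
lemma dirDeriv_pullSection_apply {σ : CH m → Triple (Cm m)} (hσ : IsSmooth σ)
    {z : AdS m} {H : Vm m} (hH : H ∈ horizontal m z) (P Q : Vm m) {w X Y Z Y' Z' : Cm m} {a b : ℂ}
    (hw : w = proj m z) (hX : X = dprojV (z : Vm m) H) (hY : Y = dprojV (z : Vm m) P)
    (hZ : Z = dprojV (z : Vm m) Q) (ha : a = herm (z : Vm m) P) (hb : b = herm (z : Vm m) Q)
    (hY' : Y' = -gammaCH w X Y + a • X) (hZ' : Z' = -gammaCH w X Z + b • X)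
    {ξ : TwoForm (Cm m)} {α : Cm m →L[ℝ] ℝ} {u : ℝ} (hσz : σ (proj m z) = (ξ, α, u))
    {ξ' : TwoForm (Cm m)} {α' : Cm m →L[ℝ] ℝ} {u' : ℝ}
    (hξ' : ξ' = dirDeriv (fun w => (σ w).1) (proj m z) X)
    (hα' : α' = dirDeriv (fun w => (σ w).2.1) (proj m z) X)
    (hu' : u' = dirDeriv (fun w => (σ w).2.2) (proj m z) X) :
    dirDeriv (pullSection m σ) z H ![P, Q] =
      (contractL (Cm m) ξ' Y Z + contractL (Cm m) ξ Y' Z + contractL (Cm m) ξ Y Z') +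
        (u' * (a.im * b.re - a.re * b.im) +
          u * ((herm H P).im * b.re + a.im * (herm H Q).re -
            ((herm H P).re * b.im + a.re * (herm H Q).im))) +
        1 / 2 * (((herm H P).re * α Z + a.re * (α' Z + α Z')) -
          ((herm H Q).re * α Y + b.re * (α' Y + α Y')) -
          ((herm H P).im * α (Complex.I • Z) +
            a.im * (α' (Complex.I • Z) + α (Complex.I • Z'))) +
          ((herm H Q).im * α (Complex.I • Y) +
            b.im * (α' (Complex.I • Y) + α (Complex.I • Y')))) := by
  have hH0 := mem_horizontal.1 hH
  obtain ⟨γ, h0, hγ, hS⟩ := exists_curve z.2 hH0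
  have hp0 : projMap m (γ 0) = (proj m z : Cm m) := by rw [h0]; rfl
  have hD : HasDerivAt (fun s => extZero (pullSection m σ) (γ s) ![P, Q])
      (dirDeriv (pullSection m σ) z H ![P, Q]) 0 := by
    have h1 := hasDerivAt_extZero_comp z ((isSmooth_pullSection hσ).differentiableWithinAt z)
      h0 hγ hS
    have h2 := hasDerivAt_form_apply h1 (hasDerivAt_const (0 : ℝ) P) (hasDerivAt_const (0 : ℝ) Q)
    simpa only [contractL_apply, map_zero, zero_apply, add_zero] using h2
  have hp := hasDerivAt_projMap_comp z.2 h0 hγ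
  rw [← hX] at hp
  have hCH : ∀ᶠ s in nhds 0, projMap m (γ s) ∈ CH m := hS.mono fun s hs => projMap_mem hs
  have hξ := hasDerivAt_extZero_comp (proj m z) (hσ.comp_fst.differentiableWithinAt _)
    hp0 hp hCH
  have hα := hasDerivAt_extZero_comp (proj m z) (hσ.comp_snd_fst.differentiableWithinAt _)
    hp0 hp hCH
  have hu := hasDerivAt_extZero_comp (proj m z) (hσ.comp_snd_snd.differentiableWithinAt _)
    hp0 hp hCH
  have hdP := hasDerivAt_dprojV_comp z.2 hH0 h0 hγ P
  have hdQ := hasDerivAt_dprojV_comp z.2 hH0 h0 hγ Q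
  have hF := hasDerivAt_theta_formula hξ hα hu hdP hdQ (hasDerivAt_herm_comp hγ P)
    (hasDerivAt_herm_comp hγ Q)
  have hE := hF.congr_of_eventuallyEq
    (hS.mono fun s hs => extZero_pullSection_apply σ hs P Q)
  have e1 : extZero (fun w => (σ w).1) (proj m z : Cm m) = ξ :=
    (extZero_apply (fun w => (σ w).1) (proj m z)).trans (by rw [hσz])
  have e2 : extZero (fun w => (σ w).2.1) (proj m z : Cm m) = α :=
    (extZero_apply (fun w => (σ w).2.1) (proj m z)).trans (by rw [hσz])
  have e3 : extZero (fun w => (σ w).2.2) (proj m z : Cm m) = u :=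
    (extZero_apply (fun w => (σ w).2.2) (proj m z)).trans (by rw [hσz])
  have hpz : projMap m (z : Vm m) = w := hw.symm
  rw [hD.unique hE, hp0, h0, e1, e2, e3, ← hξ', ← hα', ← hu', hpz, ← hX, ← hY, ← hZ, ← ha, ← hb,
    ← hY', ← hZ']

/-- In horizontal directions the flat derivative of `Ψ^*σ` is `θ` applied to `∇^{CH} σ`. -/
lemma dirDeriv_pullSection {σ : CH m → Triple (Cm m)} (hσ : σ ∈ SectionsE (mulI (Cm m)) (CH m))
    {z : AdS m} {H : Vm m} (hH : H ∈ horizontal m z) :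
    dirDeriv (pullSection m σ) z H = theta m z
      (nablaCH (metricCH m) (mulI (Cm m)) σ (proj m z) (dprojV (z : Vm m) H)) := by
  refine twoForm_ext fun P Q => ?_
  obtain ⟨ξ, α, u, hσz⟩ : ∃ ξ α u, σ (proj m z) = (ξ, α, u) := ⟨_, _, _, rfl⟩
  rw [dirDeriv_pullSection_apply hσ.1 hH P Q rfl rfl rfl rfl rfl rfl rfl rfl hσz rfl rfl rfl,
    theta_apply]
  have hJ := hσ.2 (proj m z)
  rw [FibreE_iff, hσz] at hJ
  have hP := metricCH_dprojV hH P
  have hQ := metricCH_dprojV hH Q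
  have hIP := metricCH_I_dprojV hH P
  have hIQ := metricCH_I_dprojV hH Q
  have hsk : ∀ U : Cm m, metricCH m (proj m z) (dprojV (z : Vm m) H) (Complex.I • U) =
      -metricCH m (proj m z) (Complex.I • dprojV (z : Vm m) H) U := fun U => by
    have := metricCH_J (proj m z : Cm m) (dprojV (z : Vm m) H) U
    simp only [mulI_apply] at this
    linarith
  -- The terms with `u` match because `dπ` is an isometry on horizontal vectors, which turns `Ω`
  -- into the components of the Hermitian form at `H`.
  have hII : ∀ U : Cm m, metricCH m (proj m z) (Complex.I • dprojV (z : Vm m) H)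
      (Complex.I • U) = metricCH m (proj m z) (dprojV (z : Vm m) H) U := fun U => by
    have := hsk (Complex.I • U)
    rw [smul_smul, Complex.I_mul_I, neg_one_smul, map_neg] at this
    linarith
  simp only [nablaCH, hσz]
  generalize dirDeriv (fun w => (σ w).2.2) (proj m z) _ = u'
  simp only [nablaForm, nablaCov, hσz]
  generalize dirDeriv (fun w => (σ w).1) (proj m z) _ = ξ'
  generalize dirDeriv (fun w => (σ w).2.1) (proj m z) _ = α'
  rw [christoffel_metricCH (proj m z).2]
  have hkf : ∀ U V : Cm m, kahlerForm (metricCH m (proj m z)) (mulI (Cm m)) ![U, V] =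
      metricCH m (proj m z) U (Complex.I • V) := fun U V =>
    kahlerForm_apply (metricCH_symm _) (metricCH_J _) U V
  have hΓ := gammaCH_csmul (proj m z : Cm m) (dprojV (z : Vm m) H) Complex.I
  generalize gammaCH (proj m z : Cm m) (dprojV (z : Vm m) H) = Γ at hΓ ⊢
  simp only [contractL_apply, ContinuousAlternatingMap.add_apply,
    ContinuousAlternatingMap.sub_apply, ContinuousAlternatingMap.smul_apply, wedge_apply,
    covJ_apply, skew_apply, add_apply, sub_apply, smul_apply, contract_apply, hkf,
    ContinuousLinearMap.comp_apply, smul_eq_mul, mulI_apply, Matrix.cons_val_zero,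
    Matrix.cons_val_one, hsk, hII, hP, hQ, hIP, hIQ, hΓ]
  generalize dprojV (z : Vm m) P = Y
  generalize dprojV (z : Vm m) Q = Z
  generalize dprojV (z : Vm m) H = X
  -- The terms with `ξ` match because `ξ` is `J`-invariant.
  have h1 : ∀ (c : ℂ) (G U : Cm m), ξ ![-G + c • X, U] =
      -ξ ![G, U] + c.re * ξ ![X, U] - c.im * ξ ![X, Complex.I • U] := fun c G U => by
    rw [neg_add_eq_sub, form_sub_left, form_csmul_left, LambdaJ_I_left hJ]
    ring
  have h2 : ∀ (c : ℂ) (G U : Cm m), ξ ![U, -G + c • X] =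
      -ξ ![U, G] - c.re * ξ ![X, U] + c.im * ξ ![X, Complex.I • U] := fun c G U => by
    rw [form_swap ξ (-G + c • X) U, h1, form_swap ξ U G]
    ring
  have h3 : ∀ (c : ℂ) (G : Cm m), α (-G + c • X) =
      -α G + c.re * α X + c.im * α (Complex.I • X) := fun c G => by
    rw [map_add, map_neg, covector_smul]
    ring
  have h4 : ∀ (c : ℂ) (G : Cm m), α (Complex.I • (-G + c • X)) =
      -α (Complex.I • G) + c.re * α (Complex.I • X) - c.im * α X := fun c G => by
    rw [smul_add, smul_neg, smul_smul, h3]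
    simp
    ring
  simp only [h1, h2, h3, h4, form_swap ξ Y (Γ Z)]
  ring

/-- The flat derivative preserves `J`-invariance, since the `J`-invariant forms are the kernel of a
linear map. -/
lemma dirDeriv_pullSection_mem {σ : CH m → Triple (Cm m)}
    (hσ : σ ∈ SectionsE (mulI (Cm m)) (CH m)) {z : AdS m} {H : Vm m} (hH : H ∈ horizontal m z) :
    dirDeriv (pullSection m σ) z H ∈ LambdaJ (mulI (Vm m)) := by
  obtain ⟨γ, h0, hγ, hS⟩ := exists_curve z.2 (mem_horizontal.1 hH)
  have h1 := hasDerivAt_extZero_comp z ((isSmooth_pullSection hσ.1).differentiableWithinAt z)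
    h0 hγ hS
  have h2 : ∀ P Q : Vm m, HasDerivAt (fun s => extZero (pullSection m σ) (γ s) ![P, Q])
      (dirDeriv (pullSection m σ) z H ![P, Q]) 0 := fun P Q => by
    have h := hasDerivAt_form_apply h1 (hasDerivAt_const (0 : ℝ) P) (hasDerivAt_const (0 : ℝ) Q)
    simpa only [contractL_apply, map_zero, zero_apply, add_zero] using h
  rw [mem_LambdaJ]
  intro P Q
  refine (h2 _ _).unique ((h2 P Q).congr_of_eventuallyEq (hS.mono fun s hs => ?_))
  have h3 : extZero (pullSection m σ) (γ s) = pullSection m σ ⟨γ s, hs⟩ :=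
    extZero_apply (pullSection m σ) ⟨γ s, hs⟩
  change extZero (pullSection m σ) (γ s) ![_, _] = extZero (pullSection m σ) (γ s) ![_, _]
  rw [h3]
  exact mem_LambdaJ.1 (theta_mem (hσ.2 _)) P Q

end Connections

/-! ### Parallel sections -/

section Parallel

variable {m : ℕ}

lemma theta_zero (z : AdS m) : theta m z 0 = 0 := by
  have := theta_smul 0 z 0
  rwa [zero_smul, zero_smul] at this

/-- For a parallel section `σ` the form `Ψ^*σ` is constant: it descends to a map on the ball, whose
derivative vanishes because every vector has a horizontal lift. -/
lemma pullSection_eq_of_parallel {σ : CH m → Triple (Cm m)}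
    (hσ : σ ∈ ParallelE (metricCH m) (mulI (Cm m)) (CH m) (isOpen_CH m)) (z z' : AdS m) :
    pullSection m σ z = pullSection m σ z' := by
  have hΦ : IsSmooth (pullSection m σ) := isSmooth_pullSection hσ.1.1
  set G : Cm m → TwoForm (Vm m) := fun w => extZero (pullSection m σ) (sec w) with hG
  have hG1 : ∀ y : AdS m, G (projMap m y) = pullSection m σ y := by
    intro y
    have h1 : G (projMap m y) = pullSection m σ (secAdS (proj m y)) :=
      extZero_apply (pullSection m σ) (secAdS (proj m y))
    rw [h1, pullSection, pullSection, proj_secAdS]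
    exact theta_congr (proj_secAdS _) (hσ.1.2 _)
  have hG2 : DifferentiableOn ℝ G (CH m) :=
    (ContDiffOn.comp hΦ contDiffOn_sec fun w hw => sec_mem hw).differentiableOn (by simp)
  have hG3 : Set.EqOn (fderiv ℝ G) 0 (CH m) := by
    intro w hw
    ext1 X
    set y := secAdS ⟨w, hw⟩ with hy
    have hyw : projMap m y = w := projMap_sec hw
    have hH : hlift (y : Vm m) X ∈ horizontal m y := mem_horizontal.2 (herm_hlift y.2 X)
    obtain ⟨γ, h0, hγ, hS⟩ := exists_curve y.2 (herm_hlift y.2 X)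
    have h1 := hasDerivAt_extZero_comp y (hΦ.differentiableWithinAt y) h0 hγ hS
    rw [dirDeriv_pullSection hσ.1 hH, hσ.2, theta_zero] at h1
    have h2 := hasDerivAt_projMap_comp y.2 h0 hγ
    rw [dprojV_hlift y.2] at h2
    have h3 : HasFDerivAt G (fderiv ℝ G w) (projMap m (γ 0)) := by
      rw [h0, hyw]
      exact (hG2.differentiableAt ((isOpen_CH m).mem_nhds hw)).hasFDerivAt
    have h4 := h3.comp_hasDerivAt (0 : ℝ) h2
    refine h4.unique (h1.congr_of_eventuallyEq (hS.mono fun s hs => ?_))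
    exact (hG1 ⟨γ s, hs⟩).trans (extZero_apply (pullSection m σ) ⟨γ s, hs⟩).symm
  rw [← hG1, ← hG1]
  exact (isOpen_CH m).is_const_of_fderiv_eq_zero (convex_ball 0 1).isPreconnected hG2 hG3
    (projMap_mem z.2) (projMap_mem z'.2)

lemma isSmooth_const {F W : Type*} [NormedAddCommGroup F] [NormedSpace ℝ F]
    [NormedAddCommGroup W] [NormedSpace ℝ W] {S : Set F} (c : W) :
    IsSmooth (fun _ : S => c) := by
  have h : ContDiffOn ℝ ∞ (fun _ : F => c) S := contDiffOn_const
  exact h.congr fun x hx => extZero_apply (fun _ : S => c) ⟨x, hx⟩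

lemma const_mem_invariantSections {φ : TwoForm (Vm m)} (hφ : φ ∈ LambdaJ (mulI (Vm m))) :
    (fun _ => φ) ∈ InvariantSections m :=
  ⟨isSmooth_const φ, fun _ => hφ, fun c _ _ _ X Y => LambdaJ_circle hφ c X Y⟩

lemma dirDeriv_const (φ : TwoForm (Vm m)) {z : AdS m} {H : Vm m} (hH : H ∈ horizontal m z) :
    dirDeriv (fun _ : AdS m => φ) z H = 0 := by
  obtain ⟨γ, h0, hγ, hS⟩ := exists_curve z.2 (mem_horizontal.1 hH)
  have h1 := hasDerivAt_extZero_comp z ((isSmooth_const φ).differentiableWithinAt z) h0 hγ hS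
  refine h1.unique ((hasDerivAt_const (0 : ℝ) φ).congr_of_eventuallyEq (hS.mono fun s hs => ?_))
  exact extZero_apply (fun _ : AdS m => φ) ⟨γ s, hs⟩

lemma descend_const_mem {φ : TwoForm (Vm m)} (hφ : φ ∈ LambdaJ (mulI (Vm m))) :
    descend (fun _ => φ) ∈ ParallelE (metricCH m) (mulI (Cm m)) (CH m) (isOpen_CH m) := by
  have hc := const_mem_invariantSections hφ
  refine ⟨descend_mem hc, fun w X => ?_⟩
  set z := secAdS w
  have hH : hlift (z : Vm m) X ∈ horizontal m z := mem_horizontal.2 (herm_hlift z.2 X)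
  have h1 := dirDeriv_pullSection (descend_mem hc) hH
  rw [pullSection_descend hc, dirDeriv_const φ hH, dprojV_hlift z.2, proj_secAdS,
    ← theta_zero z] at h1
  rw [← psi_theta z (nablaCH _ _ _ w X), ← h1, psi_theta]

/-- The origin of the ball model. -/
def originCH (m : ℕ) : CH m := ⟨0, Metric.mem_ball_self one_pos⟩

/-- Parallel sections of `𝓔` correspond to constant `J`-invariant forms. -/
def parallelEquiv (m : ℕ) : ParallelE (metricCH m) (mulI (Cm m)) (CH m) (isOpen_CH m) ≃ₗ[ℝ]
    LambdaJ (mulI (Vm m)) where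
  toFun σ := ⟨pullSection m σ.1 (secAdS (originCH m)), theta_mem (σ.2.1.2 _)⟩
  invFun φ := ⟨descend (fun _ => φ.1), descend_const_mem φ.2⟩
  map_add' σ τ := Subtype.ext (congrFun (pullSection_add σ.1 τ.1) _)
  map_smul' c σ := Subtype.ext (congrFun (pullSection_smul c σ.1) _)
  left_inv σ := by
    refine Subtype.ext ?_
    have h : (fun _ => pullSection m σ.1 (secAdS (originCH m))) = pullSection m σ.1 :=
      funext fun z => pullSection_eq_of_parallel σ.2 _ z
    change descend (fun _ => pullSection m σ.1 (secAdS (originCH m))) = σ.1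
    rw [h, descend_pullSection]
  right_inv φ := Subtype.ext
    (congrFun (pullSection_descend (const_mem_invariantSections φ.2)) (secAdS (originCH m)))

lemma parallelEquiv_apply (σ : ParallelE (metricCH m) (mulI (Cm m)) (CH m) (isOpen_CH m))
    (z : AdS m) : pullSection m σ.1 z = parallelEquiv m σ :=
  pullSection_eq_of_parallel σ.2 z _

end Parallel

/-! ### Primitive forms -/

section Primitive

variable {m : ℕ}

lemma toEnd_comp_dprojV (z : AdS m) (ξ : TwoForm (Cm m)) :
    toEnd (mink m) (ξ.compContinuousLinearMap (dprojV (z : Vm m))) =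
      (hlift (z : Vm m) : Cm m →ₗ[ℝ] Vm m) ∘ₗ toEnd (metricCH m (proj m z)) ξ ∘ₗ
        (dprojV (z : Vm m) : Vm m →ₗ[ℝ] Cm m) := by
  refine toEnd_unique mink_isInvertible fun P Q => ?_
  have h : (dprojV (z : Vm m)) ∘ ![P, Q] = ![dprojV (z : Vm m) P, dprojV (z : Vm m) Q] := by
    ext i; fin_cases i <;> rfl
  rw [ContinuousAlternatingMap.compContinuousLinearMap_apply, h,
    ← toEnd_spec (metricCH_isInvertible (proj m z).2)]
  exact mink_hlift z.2 _ Q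

/-- The inner product of a form pulled back from `ℂH^m` with the Kähler form is computed on
`ℂH^m`, by cyclicity of the trace. -/
lemma formInner_comp_dprojV (z : AdS m) (ξ : TwoForm (Cm m)) :
    formInner (mink m) (ξ.compContinuousLinearMap (dprojV (z : Vm m)))
      (kahlerForm (mink m) (mulI (Vm m))) =
    formInner (metricCH m (proj m z)) ξ (kahlerForm (metricCH m (proj m z)) (mulI (Cm m))) := by
  rw [formInner_kahler mink_isInvertible mink_symm mink_J,
    formInner_kahler (metricCH_isInvertible (proj m z).2) (metricCH_symm _) (metricCH_J _),
    toEnd_comp_dprojV, LinearMap.comp_assoc, LinearMap.trace_comp_comm']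
  congr 2
  refine LinearMap.ext fun X => ?_
  change toEnd _ ξ (dprojV (z : Vm m) (Complex.I • hlift (z : Vm m) X)) =
    toEnd _ ξ (Complex.I • X)
  rw [dprojV_csmul, dprojV_hlift z.2]

/-- The form `θ_z(ξ, α, u)` is primitive if and only if `g(ξ, Ω) = u`. -/
lemma formInner_theta (z : AdS m) (e : Triple (Cm m)) :
    formInner (mink m) (theta m z e) (kahlerForm (mink m) (mulI (Vm m))) =
      formInner (metricCH m (proj m z)) e.1
        (kahlerForm (metricCH m (proj m z)) (mulI (Cm m))) - e.2.2 := by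
  have hw : ∀ (p : Vm m) (b : Vm m →L[ℝ] ℝ), formInner (mink m) (wedge (mink m p) b)
      (kahlerForm (mink m) (mulI (Vm m))) = -b (Complex.I • p) := fun p b =>
    formInner_wedge_kahler mink_isInvertible mink_symm mink_J p b
  simp only [theta, dproj_eq]
  rw [formInner_add, formInner_add, formInner_smul, formInner_smul, formInner_add,
    formInner_comp_dprojV, hw, hw, hw]
  have h1 : mink m (z : Vm m) (z : Vm m) = -1 := z.2
  simp [mulI_apply, dprojV_csmul, dprojV_self z.2, smul_smul, h1]
  ring

lemma parallelEquiv_mem_iff (σ : ParallelE (metricCH m) (mulI (Cm m)) (CH m) (isOpen_CH m)) :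
    (parallelEquiv m σ : TwoForm (Vm m)) ∈ LambdaJ0 (mink m) (mulI (Vm m)) ↔
      σ.1 ∈ ParallelE0 (metricCH m) (mulI (Cm m)) (CH m) (isOpen_CH m) := by
  have key : ∀ z : AdS m, formInner (mink m) (parallelEquiv m σ)
      (kahlerForm (mink m) (mulI (Vm m))) = _ := fun z =>
    (congrArg (fun φ => formInner (mink m) φ _) (parallelEquiv_apply σ z).symm).trans
      (formInner_theta z (σ.1 (proj m z)))
  constructor
  · rintro ⟨-, h⟩
    refine ⟨σ.2, fun w => ?_⟩
    have := key (secAdS w)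
    rw [h, proj_secAdS] at this
    linarith
  · rintro ⟨-, h⟩
    refine ⟨(parallelEquiv m σ).2, ?_⟩
    rw [key (secAdS (originCH m)), h, sub_self]

/-- The parallel sections in `𝓝₀` correspond to the primitive forms. -/
def parallelEquiv0 (m : ℕ) : ParallelE0 (metricCH m) (mulI (Cm m)) (CH m) (isOpen_CH m) ≃ₗ[ℝ]
    LambdaJ0 (mink m) (mulI (Vm m)) where
  toFun σ := ⟨parallelEquiv m ⟨σ.1, σ.2.1⟩, (parallelEquiv_mem_iff ⟨σ.1, σ.2.1⟩).2 σ.2⟩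
  invFun φ := ⟨(parallelEquiv m).symm ⟨φ.1, φ.2.1⟩, (parallelEquiv_mem_iff _).1 (by
    rw [LinearEquiv.apply_symm_apply]; exact φ.2)⟩
  map_add' σ τ := by
    have h := congrArg Subtype.val ((parallelEquiv m).map_add ⟨σ.1, σ.2.1⟩ ⟨τ.1, τ.2.1⟩)
    exact Subtype.ext h
  map_smul' c σ := by
    have h := congrArg Subtype.val ((parallelEquiv m).map_smul c ⟨σ.1, σ.2.1⟩)
    exact Subtype.ext h
  left_inv σ := by
    have h := congrArg Subtype.val ((parallelEquiv m).symm_apply_apply ⟨σ.1, σ.2.1⟩)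
    exact Subtype.ext h
  right_inv φ := by
    have h := congrArg Subtype.val ((parallelEquiv m).apply_symm_apply ⟨φ.1, φ.2.1⟩)
    exact Subtype.ext h

end Primitive

end ComplexHyperbolic

end

theorem mainTheorem6 (m : ℕ) :
    -- `π` is the quotient map of `AdS` by the circle action, and the metric of `ℂH^m` is the
    -- induced one
    (∀ w : CH m, ∃ z : AdS m, proj m z = w) ∧
    (∀ z z' : AdS m, proj m z = proj m z' ↔ ∃ c : Circle, (z' : Vm m) = (c : ℂ) • (z : Vm m)) ∧
    (∀ z : AdS m, Set.BijOn (dproj m z) (horizontal m z) Set.univ ∧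
      ∀ H ∈ horizontal m z, ∀ K ∈ horizontal m z,
        metricCH m (proj m z) (dproj m z H) (dproj m z K) = mink m H K) ∧
    -- the bundle isomorphism `Ψ`
    ∃ Ψ : (z : AdS m) → LambdaJ (mulI (Vm m)) ≃ₗ[ℝ] FibreE (mulI (Cm m)),
      -- `Ψ_z` is the inverse of `θ_z`
      (∀ (z : AdS m) (e : FibreE (mulI (Cm m))), ((Ψ z).symm e : TwoForm (Vm m)) = theta m z e) ∧
      -- `Ψ` is `𝕊¹`-invariant
      (∀ (c : Circle) (z z' : AdS m), (z' : Vm m) = (c : ℂ) • (z : Vm m) →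
        ∀ φ φ' : LambdaJ (mulI (Vm m)),
          (∀ X Y : Vm m, φ'.1 ![(c : ℂ) • X, (c : ℂ) • Y] = φ.1 ![X, Y]) → Ψ z' φ' = Ψ z φ) ∧
      -- `Ψ^*` is an isomorphism at the level of sections
      (∃ Ψs : SectionsE (mulI (Cm m)) (CH m) ≃ₗ[ℝ] InvariantSections m,
        ∀ σ : SectionsE (mulI (Cm m)) (CH m), (Ψs σ : AdS m → TwoForm (Vm m)) = pullSection m σ) ∧
      -- `Ψ` identifies `D` and `∇^{CH}` in the horizontal directions
      (∀ σ ∈ SectionsE (mulI (Cm m)) (CH m), ∀ z : AdS m, ∀ H ∈ horizontal m z,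
        ∃ h : dirDeriv (pullSection m σ) z H ∈ LambdaJ (mulI (Vm m)),
          nablaCH (metricCH m) (mulI (Cm m)) σ (proj m z) (dproj m z H) =
            Ψ z ⟨dirDeriv (pullSection m σ) z H, h⟩) ∧
      -- the parallel sections are the constant `J`-invariant two-forms
      (∃ P : ParallelE (metricCH m) (mulI (Cm m)) (CH m) (isOpen_CH m) ≃ₗ[ℝ]
          LambdaJ (mulI (Vm m)),
        ∀ (σ : ParallelE (metricCH m) (mulI (Cm m)) (CH m) (isOpen_CH m)) (z : AdS m),
          pullSection m σ z = P σ) ∧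
      -- and those in `𝓝₀` are the primitive ones
      (∃ P₀ : ParallelE0 (metricCH m) (mulI (Cm m)) (CH m) (isOpen_CH m) ≃ₗ[ℝ]
          LambdaJ0 (mink m) (mulI (Vm m)),
        ∀ (σ : ParallelE0 (metricCH m) (mulI (Cm m)) (CH m) (isOpen_CH m)) (z : AdS m),
          pullSection m σ z = P₀ σ) := by
  refine ⟨fun w => ⟨secAdS w, proj_secAdS w⟩, proj_eq_iff,
    fun z => ⟨bijOn_dproj z, fun H hH K _ => metricCH_dproj hH K⟩, Psi, coe_Psi_symm, Psi_circle,
    ⟨sectionsEquiv, fun σ => rfl⟩, fun σ hσ z H hH => ?_,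
    ⟨parallelEquiv m, parallelEquiv_apply⟩,
    ⟨parallelEquiv0 m, fun σ z => parallelEquiv_apply ⟨σ.1, σ.2.1⟩ z⟩⟩
  have h := dirDeriv_pullSection hσ hH
  have hmem := dirDeriv_pullSection_mem hσ hH
  refine ⟨hmem, ?_⟩
  rw [coe_Psi, dproj_eq]
  exact ((congrArg (psi (z : Vm m)) h).trans (psi_theta z _)).symm
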